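/- Let $p$ be an odd prime, $m\ge 1$ and $k,\ell\ge 0$ integers, $u=\gcd(k,m)$, $v=\gcd(\ell,m)$ (with $\gcd(0,m)=m$), let $v_2$ be the 2-adic valuation and $\mathrm{Tr}$ the trace from $\mathbb F_{p^m}$ to $\mathbb F_p$. For $c\in\mathbb F_p$ put $$D=\{(x,y)\in\mathbb F_{p^m}^2\setminus\{(0,0)\}:\ \mathrm{Tr}(x^{p^k+1}+y^{p^\ell+1})=c\},\qquad \mathcal C_D=\{(\mathrm{Tr}(ax+by))_{(x,y)\in D}:\ a,b\in\mathbb F_{p^m}\}.$$ For a linear code $\mathcal C\subseteq\mathbb F_p^n$ let $A_i$ be the number of codewords of Hamming weight $i$. Its weight enumerator is $\sum_{i=0}^n A_ix^i$, its complete weight enumerator is $\sum_{\mathbf c\in\mathcal C}\prod_{\rho\in\mathbb F_p}w_\rho^{k_\rho(\mathbf c)}$, where $k_\rho(\mathbf c)$ is the number of components of $\mathbf c$ equal to $\rho$, and $\mathcal C$ is called a two-weight code if exactly two of $A_1,\dots,A_n$ are nonzero. Let $\eta$ be the quadratic character of $\mathbb F_p$, with $\eta(0)=0$, and put $\varepsilon=(-1)^{(p-1)m/2}$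 and $\varepsilon'=(-1)^{(p-1)(m+1)/2}$. Suppose $2v_2(m)=v_2(u)+v_2(v)$. (1) Let $c=0$ and exclude the case $m=1$, $p\equiv 3\pmod 4$ (in which $D=\emptyset$). Then $\mathcal C_D$ is a two-weight linear code of dimension $2m$ and length $$n=|D|=p^{2m-1}+\varepsilon(p-1)p^{m-1}-1,$$ with weight enumerator $$1+\bigl(p^{2m-1}+\varepsilon(p-1)p^{m-1}-1\bigr)x^{(p-1)p^{2m-2}}+(p-1)\bigl(p^{2m-1}-\varepsilon p^{m-1}\bigr)x^{(p-1)(p^{2m-2}+\varepsilon p^{m-1})}$$ and complete weight enumerator $$w_0^{n}+\bigl(p^{2m-1}+\varepsilon(p-1)p^{m-1}-1\bigr)w_0^{p^{2m-2}+\varepsilon(p-1)p^{m-1}-1}\prod_{\rho\in\mathbb F_p^*}w_\rho^{p^{2m-2}}+(p-1)\bigl(p^{2m-1}-\varepsilon p^{m-1}\bigr)w_0^{p^{2m-2}-1}\prod_{\rho\in\mathbb F_p^*}w_\rho^{p^{2m-2}+\varepsilon p^{m-1}}.$$ (2) Let $c\in\mathbb F_p^*$ and let $g$ be a generator of $\mathbb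 F_p^*$. Then $\mathcal C_D$ is a two-weight linear code of dimension $2m$ and length $$n=|D|=p^{2m-1}-\varepsilon p^{m-1},$$ with weight enumerator $$1+\Bigl(\tfrac{p+1}2p^{2m-1}+\tfrac{p-1}2\varepsilon p^{m-1}-1\Bigr)x^{(p-1)p^{2m-2}}+\tfrac{p-1}2\bigl(p^{2m-1}-\varepsilon p^{m-1}\bigr)x^{(p-1)p^{2m-2}-2\varepsilon p^{m-1}}$$ and complete weight enumerator $$w_0^{n}+\bigl(p^{2m-1}+\varepsilon(p-1)p^{m-1}-1\bigr)w_0^{p^{2m-2}-\varepsilon p^{m-1}}\prod_{\rho\in\mathbb F_p^*}w_\rho^{p^{2m-2}}$$ $$+\bigl(p^{2m-1}-\varepsilon p^{m-1}\bigr)\Biggl(\sum_{j=1}^{(p-1)/2}w_0^{p^{2m-2}+\varepsilon' p^{m-1}}\,w_{2g^j}^{p^{2m-2}}\,w_{-2g^j}^{p^{2m-2}}\prod_{\substack{\rho\in\mathbb F_p^*\\ \rho\ne\pm2g^j}}w_\rho^{p^{2m-2}+\varepsilon p^{m-1}\eta(\rho^2-4g^{2j})}$$ $$+\sum_{j=1}^{(p-1)/2}w_0^{p^{2m-2}-\varepsilon'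 p^{m-1}}\prod_{\rho\in\mathbb F_p^*}w_\rho^{p^{2m-2}+\varepsilon p^{m-1}\eta(\rho^2-4g^{2j+1})}\Biggr).$$ -/

import Mathlib

open scoped BigOperators

namespace FewWeightCode

section Codes

variable {p : ℕ} [Fact p.Prime] {ι : Type*} [Fintype ι]

/-- The number of codewords of Hamming weight `i` in the linear code `C ⊆ 𝔽_p^ι`. -/
noncomputable def weightCount (C : Submodule (ZMod p) (ι → ZMod p)) (i : ℕ) : ℕ :=
  Nat.card {w : ι → ZMod p // w ∈ C ∧ hammingNorm w = i}

/-- The weight enumerator `∑ A_i x^i` (`0 ≤ i ≤ n`) of a linear code of length `n`. -/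
noncomputable def weightEnumerator (C : Submodule (ZMod p) (ι → ZMod p)) : Polynomial ℤ :=
  ∑ i ∈ Finset.range (Fintype.card ι + 1),
    Polynomial.C (weightCount C i : ℤ) * Polynomial.X ^ i

/-- `C` is a `t`-weight code: exactly `t` of the numbers `A_1, …, A_n` are nonzero. -/
def IsWeightCode (t : ℕ) (C : Submodule (ZMod p) (ι → ZMod p)) : Prop :=
  {i : ℕ | 1 ≤ i ∧ i ≤ Fintype.card ι ∧ weightCount C i ≠ 0}.ncard = t

/-- The number of components of `w` that are equal to `ρ`. -/
def symbolCount (w : ι → ZMod p) (ρ : ZMod p) : ℕ :=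
  (Finset.univ.filter fun i => w i = ρ).card

open Classical in
/-- The complete weight enumerator `∑_{w ∈ C} ∏_ρ w_ρ^{k_ρ(w)}`, a polynomial in the variables
`w_ρ`, `ρ ∈ 𝔽_p`. -/
noncomputable def completeWeightEnumerator (C : Submodule (ZMod p) (ι → ZMod p)) :
    MvPolynomial (ZMod p) ℤ :=
  ∑ w ∈ Finset.univ.filter (fun w : ι → ZMod p => w ∈ C),
    ∏ ρ : ZMod p, MvPolynomial.X ρ ^ symbolCount w ρ

end Codes

section Construction

/-- The defining set of all `(x, y) ≠ (0, 0)` in `F²` with `Tr(x^{p^k+1} + y^{p^l+1}) = c`. -/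
noncomputable def definingSet (p : ℕ) [Fact p.Prime] (F : Type*) [Field F] [Fintype F]
    [DecidableEq F] [Algebra (ZMod p) F] (k l : ℕ) (c : ZMod p) : Finset (F × F) :=
  Finset.univ.filter fun z =>
    z ≠ (0, 0) ∧ Algebra.trace (ZMod p) F (z.1 ^ (p ^ k + 1) + z.2 ^ (p ^ l + 1)) = c

/-- The map `(a, b) ↦ (Tr(ax + by))_{(x, y) ∈ D}`. -/
noncomputable def codeword (p : ℕ) [Fact p.Prime] {F : Type*} [Field F] [Algebra (ZMod p) F]
    (D : Finset (F × F)) : (F × F) →ₗ[ZMod p] (D → ZMod p) where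
  toFun ab := fun d => Algebra.trace (ZMod p) F (ab.1 * d.1.1 + ab.2 * d.1.2)
  map_add' ab ab' := by
    funext d
    simp only [Prod.fst_add, Prod.snd_add, Pi.add_apply, ← map_add]
    congr 1
    ring
  map_smul' r ab := by
    funext d
    simp only [Prod.smul_fst, Prod.smul_snd, Pi.smul_apply, RingHom.id_apply, smul_mul_assoc,
      ← smul_add, map_smul]

/-- The linear code `C_D = {(Tr(ax + by))_{(x, y) ∈ D} : a, b ∈ F}`, of length `|D|`, with
coordinates indexed by `D`. -/
noncomputable def traceCode (p : ℕ) [Fact p.Prime] {F : Type*} [Field F] [Algebra (ZMod p) F]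
    (D : Finset (F × F)) : Submodule (ZMod p) (D → ZMod p) :=
  LinearMap.range (codeword p D)

end Construction

/-- The sign `(-1)^{(p-1)r/2}`; the division is exact for odd `p`. -/
def sgn (p r : ℕ) : ℤ := (-1) ^ ((p - 1) * r / 2)

end FewWeightCode

open FewWeightCode

/-! ### The 2-adic condition -/

namespace FewWeightCode

/-! Write Q(x, y) = Tr(x^{p^k+1} + y^{p^l+1}), a quadratic form over 𝔽_p, and P = p^{m-1}. Neither
valuation on the right of the 2-adic hypothesis exceeds v_2(m), so both equal it and m / gcd(k, m),
m / gcd(l, m) are odd. The proof uses this only as: some odd r has m ∣ k * r, and likewise for l. An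
odd number of iterations of x ↦ x^{p^k} is then the identity.

This has two consequences. First, x^{p^k+1} takes each value exactly as often as x^2
(`card_pow_fiber_eq`), so the level sets of Q have the sizes they have for Tr(x^2 + y^2), which come
from counting sums of two squares (`card_traceForm_eq`). Second, the polar form of Q is
nondegenerate (`adjointPair_bijective`), so every functional Tr(ax + by) is the polar form against a
unique vector w.

The number of symbols ρ in the codeword of w is the number of z with Q(z) = c and polar value ρ, up
to removal of the origin. Summing the sizes of the level sets of Q over the values c + νρ + ν²Q(w),
ν in 𝔽_p, expresses it through the number of roots ν of c + νρ + ν²Q(w) (`sum_card_along_line`,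
`card_traceForm_eq_and_functional_eq`). For Q(w) ≠ 0 that number is 1 + η(ρ² - 4cQ(w)). Hence the
composition of a nonzero codeword depends only on Q(w), and since the level sets of Q are already
counted, both enumerators follow (`sum_traceForm`). -/

lemma exists_odd_dvd_mul {m k : ℕ} (hm : 0 < m)
    (h : padicValNat 2 (Nat.gcd k m) = padicValNat 2 m) : ∃ r, Odd r ∧ m ∣ k * r := by
  have hg : Nat.gcd k m ∣ m := Nat.gcd_dvd_right k m
  have hr : 0 < m / Nat.gcd k m := Nat.div_pos (Nat.le_of_dvd hm hg) (Nat.gcd_pos_of_pos_right k hm)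
  refine ⟨m / Nat.gcd k m, ?_, ?_⟩
  · rw [← Nat.not_even_iff_odd, even_iff_two_dvd]
    intro h2
    have h0 : padicValNat 2 (m / Nat.gcd k m) = 0 := by
      rw [padicValNat.div_of_dvd hg, h, Nat.sub_self]
    have := one_le_padicValNat_of_dvd hr.ne' h2
    omega
  · obtain ⟨k', hk'⟩ := Nat.gcd_dvd_left k m
    refine ⟨k', ?_⟩
    calc k * (m / Nat.gcd k m) = Nat.gcd k m * k' * (m / Nat.gcd k m) := by rw [← hk']
      _ = Nat.gcd k m * (m / Nat.gcd k m) * k' := by ring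
      _ = m * k' := by rw [Nat.mul_div_cancel' hg]

/-- Each valuation is at most that of m, so the sum reaches twice that bound only if both attain it.
-/
lemma padicValNat_gcd_eq {m k l : ℕ} (hm : 0 < m)
    (hv : 2 * padicValNat 2 m = padicValNat 2 (Nat.gcd k m) + padicValNat 2 (Nat.gcd l m)) :
    padicValNat 2 (Nat.gcd k m) = padicValNat 2 m ∧
      padicValNat 2 (Nat.gcd l m) = padicValNat 2 m := by
  have key : ∀ j, padicValNat 2 (Nat.gcd j m) ≤ padicValNat 2 m := fun j =>
    (padicValNat_dvd_iff_le hm.ne').mp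
      ((pow_padicValNat_dvd (p := 2) (n := Nat.gcd j m)).trans (Nat.gcd_dvd_right j m))
  have := key k
  have := key l
  omega

/-! ### Finite fields: fibres of power maps and sums of two squares -/

section Field

variable {p : ℕ} {F : Type*} [Field F] [Fintype F] {m : ℕ}

lemma pow_p_pow_of_dvd (hF : Fintype.card F = p ^ m) {j : ℕ} (hj : m ∣ j) (x : F) :
    x ^ p ^ j = x := by
  obtain ⟨i, rfl⟩ := hj
  rw [pow_mul, ← hF]
  exact FiniteField.pow_card_pow i x

/-- Here x ↦ x^{p^k} inverts x, so an odd number r of iterations inverts it too. But m ∣ k * r makes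
that iterate the identity, whence x = x⁻¹. -/
lemma sq_eq_one_of_pow_eq_one (hF : Fintype.card F = p ^ m) {k r : ℕ} (hr : Odd r)
    (hd : m ∣ k * r) {x : F} (hx : x ^ (p ^ k + 1) = 1) : x ^ 2 = 1 := by
  obtain ⟨s, rfl⟩ := hr
  have h1 : x ^ p ^ k * x = 1 := by rw [← pow_succ, hx]
  have h1' : x ^ p ^ k = x⁻¹ := eq_inv_of_mul_eq_one_left h1
  have h2 : ∀ s : ℕ, x ^ p ^ (k * (2 * s)) = x := by
    intro s
    induction s with
    | zero => simp
    | succ s ih =>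
      have : p ^ (k * (2 * (s + 1))) = p ^ (k * (2 * s)) * p ^ k * p ^ k := by ring
      rw [this, pow_mul, pow_mul, ih, h1', inv_pow, h1', inv_inv]
  have h3 := pow_p_pow_of_dvd hF hd x
  rw [mul_add, pow_add, pow_mul, h2, mul_one] at h3
  rw [h3] at h1
  rw [sq, h1]

variable [Fact p.Prime]

/-- Iterating the hypothesis r times gives -x because r is odd, and x because m ∣ k * r; so 2x = 0.
-/
lemma eq_zero_of_pow_eq_neg (hp : p ≠ 2) (hF : Fintype.card F = p ^ m) [CharP F p] {k r : ℕ}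
    (hr : Odd r) (hd : m ∣ k * r) {x : F} (hx : x ^ p ^ (2 * k) = -x) : x = 0 := by
  have hodd : Odd p := (Fact.out : p.Prime).odd_of_ne_two hp
  have h2 : ∀ s : ℕ, x ^ p ^ (2 * k * s) = (-1) ^ s * x := by
    intro s
    induction s with
    | zero => simp
    | succ s ih =>
      have : p ^ (2 * k * (s + 1)) = p ^ (2 * k * s) * p ^ (2 * k) := by ring
      rw [this, pow_mul, ih, mul_pow, hx, ← pow_mul, mul_comm s, pow_mul,
        (hodd.pow).neg_one_pow, pow_succ]
      ring
  have h3 := h2 r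
  rw [pow_p_pow_of_dvd hF (by rw [mul_assoc]; exact hd.mul_left 2), hr.neg_one_pow] at h3
  have h4 : (2 : F) * x = 0 := by linear_combination h3
  have h5 : (2 : F) ≠ 0 := Ring.two_ne_zero (by rwa [ringChar.eq F p])
  simpa [h5] using h4

/-- On the unit group, raising to the power p^k + 1 and squaring have the same kernel, hence images
of equal size. As p^k + 1 is even, one image lies in the other, so they coincide. A fibre over a
nonzero s is empty or a coset of the common kernel. -/
lemma card_pow_fiber_eq [DecidableEq F] (hp : p ≠ 2) (hF : Fintype.card F = p ^ m) {k r : ℕ} (hr : Odd r)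
    (hd : m ∣ k * r) (s : F) :
    (Finset.univ.filter fun x : F => x ^ (p ^ k + 1) = s).card =
      (Finset.univ.filter fun x : F => x ^ 2 = s).card := by
  have hodd : Odd p := (Fact.out : p.Prime).odd_of_ne_two hp
  rcases eq_or_ne s 0 with rfl | hs
  · simp
  set N := p ^ k + 1 with hN
  have units : ∀ n : ℕ, n ≠ 0 → (Finset.univ.filter fun x : F => x ^ n = s).card =
      (Finset.univ.filter fun x : Fˣ => powMonoidHom n x = Units.mk0 s hs).card := by
    intro n hn
    symm
    refine Finset.card_bij (fun u _ => (u : F)) ?_ ?_ ?_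
    · intro u hu
      simpa [Units.ext_iff] using hu
    · intro u _ v _ h
      exact Units.ext h
    · intro x hx
      have hx' : x ^ n = s := by simpa using hx
      have hx0 : x ≠ 0 := by rintro rfl; exact hs (by rw [← hx', zero_pow hn])
      exact ⟨Units.mk0 x hx0, by simpa [Units.ext_iff] using hx', rfl⟩
  have hker : (powMonoidHom N : Fˣ →* Fˣ).ker = (powMonoidHom 2 : Fˣ →* Fˣ).ker := by
    ext u
    simp only [MonoidHom.mem_ker, powMonoidHom_apply]
    constructor
    · intro h
      have := sq_eq_one_of_pow_eq_one hF hr hd (x := (u : F)) (by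
        rw [← Units.val_pow_eq_pow_val, ← hN, h, Units.val_one])
      exact Units.ext (by simpa using this)
    · intro h
      obtain ⟨j, hj⟩ : Even N := (hodd.pow).add_one
      rw [hj, ← two_mul, pow_mul, h, one_pow]
  have hle : (powMonoidHom N : Fˣ →* Fˣ).range ≤ (powMonoidHom 2 : Fˣ →* Fˣ).range := by
    rintro _ ⟨u, rfl⟩
    obtain ⟨j, hj⟩ : Even N := (hodd.pow).add_one
    exact ⟨u ^ j, by simp only [powMonoidHom_apply, ← pow_mul, hj]; ring_nf⟩
  have hrange : (powMonoidHom N : Fˣ →* Fˣ).range = (powMonoidHom 2 : Fˣ →* Fˣ).range := by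
    refine Subgroup.eq_of_le_of_card_ge hle ?_
    have h1 := Subgroup.card_mul_index (powMonoidHom N : Fˣ →* Fˣ).ker
    have h2 := Subgroup.card_mul_index (powMonoidHom 2 : Fˣ →* Fˣ).ker
    rw [Subgroup.index_ker] at h1 h2
    rw [hker, ← h2] at h1
    exact (Nat.eq_of_mul_eq_mul_left Nat.card_pos h1).ge
  rw [units N (by omega), units 2 two_ne_zero]
  by_cases hmem : Units.mk0 s hs ∈ (powMonoidHom 2 : Fˣ →* Fˣ).range
  · have fib : ∀ n : ℕ, Units.mk0 s hs ∈ (powMonoidHom n : Fˣ →* Fˣ).range →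
        (Finset.univ.filter fun x : Fˣ => powMonoidHom n x = Units.mk0 s hs).card =
          Nat.card (powMonoidHom n : Fˣ →* Fˣ).ker := by
      intro n hn
      rw [MonoidHom.card_fiber_eq_of_mem_range (powMonoidHom n : Fˣ →* Fˣ) hn ⟨1, map_one _⟩,
        Nat.card_eq_fintype_card, Fintype.card_subtype]
      simp only [MonoidHom.mem_ker]
    rw [fib N (hrange ▸ hmem), fib 2 hmem, hker]
  · have emp : ∀ n : ℕ, Units.mk0 s hs ∉ (powMonoidHom n : Fˣ →* Fˣ).range →
        (Finset.univ.filter fun x : Fˣ => powMonoidHom n x = Units.mk0 s hs) = ∅ := by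
      intro n hn
      ext u
      simp only [Finset.mem_filter, Finset.mem_univ, true_and, Finset.notMem_empty, iff_false]
      exact fun h => hn ⟨u, h⟩
    rw [emp N (hrange ▸ hmem), emp 2 hmem]

/-- The number of representations of `s` as a sum of two squares in a finite field. -/
lemma card_sq_add_sq [DecidableEq F] (h2 : ringChar F ≠ 2) (s : F) :
    ((Finset.univ.filter fun z : F × F => z.1 ^ 2 + z.2 ^ 2 = s).card : ℤ) =
      Fintype.card F - quadraticChar F (-1)
        + if s = 0 then quadraticChar F (-1) * Fintype.card F else 0 := by
  set M : F → ℤ := fun s => ((Finset.univ.filter fun z : F × F => z.1 ^ 2 + z.2 ^ 2 = s).card : ℤ)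
  set e := quadraticChar F (-1)
  set q : ℤ := (Fintype.card F : ℤ) with hq
  -- For fixed y there are 1 + χ(-y²) choices of x: one if y = 0, otherwise 1 + e.
  have h0 : M 0 = 1 + (q - 1) * (1 + e) := by
    have h1 : M 0 = ∑ y : F, (quadraticChar F (-y ^ 2) + 1) := by
      simp only [M, Finset.card_filter, Fintype.sum_prod_type_right]
      push_cast
      refine Finset.sum_congr rfl fun y _ => ?_
      rw [← quadraticChar_card_sqrts h2, Set.toFinset_ofPred, Finset.card_filter]
      push_cast
      refine Finset.sum_congr rfl fun x _ => ?_
      simp only [eq_neg_iff_add_eq_zero]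
    have h3 : ∀ y : F, quadraticChar F (-y ^ 2) + 1 = (1 + e) + if y = 0 then -e else 0 := by
      intro y
      rcases eq_or_ne y 0 with rfl | hy
      · simp
      · rw [neg_eq_neg_one_mul, map_mul, quadraticChar_sq_one' hy]
        simp [hy, e, add_comm]
    rw [h1, Finset.sum_congr rfl fun y _ => h3 y, Finset.sum_add_distrib]
    simp [← hq]
    ring
  -- The form X² + Y² is multiplicative: multiplication by a + bi, with a² + b² = s, carries the
  -- solutions for 1 bijectively to those for s.
  have hne : ∀ s : F, s ≠ 0 → M s = M 1 := by
    intro s hs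
    obtain ⟨a, b, hab⟩ : ∃ a b : F, a ^ 2 + b ^ 2 = s := by
      obtain ⟨a, b, h⟩ := FiniteField.exists_root_sum_quadratic (R := F)
        (f := Polynomial.X ^ 2) (g := Polynomial.X ^ 2 - Polynomial.C s)
        (by simp) (by rw [Polynomial.degree_X_pow_sub_C two_pos]; rfl)
        (FiniteField.odd_card_of_char_ne_two h2)
      exact ⟨a, b, by simp at h; linear_combination h⟩
    simp only [M, Nat.cast_inj]
    symm
    refine Finset.card_bij' (fun z _ => (a * z.1 - b * z.2, a * z.2 + b * z.1))
      (fun z _ => (s⁻¹ * (a * z.1 + b * z.2), s⁻¹ * (a * z.2 - b * z.1))) ?_ ?_ ?_ ?_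
    · rintro ⟨x, y⟩ h
      simp only [Finset.mem_filter, Finset.mem_univ, true_and] at h ⊢
      linear_combination (a ^ 2 + b ^ 2) * h + hab
    · rintro ⟨x, y⟩ h
      simp only [Finset.mem_filter, Finset.mem_univ, true_and] at h ⊢
      field_simp
      linear_combination (a ^ 2 + b ^ 2) * h + s * hab
    · rintro ⟨x, y⟩ _
      ext
      · field_simp
        linear_combination x * hab
      · field_simp
        linear_combination y * hab
    · rintro ⟨x, y⟩ _
      ext
      · field_simp
        linear_combination x * hab
      · field_simp
        linear_combination y * hab
  have hsum : ∑ s : F, M s = q ^ 2 := by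
    simp only [M]
    rw [← Nat.cast_sum, ← Finset.card_eq_sum_card_fiberwise (fun _ _ => Finset.mem_univ _)]
    simp [q, sq]
  have hsplit : ∀ s : F, M s = M 1 + if s = 0 then M 0 - M 1 else 0 := by
    intro s
    split_ifs with h
    · rw [h]; ring
    · rw [hne s h]; ring
  have hq1 : q - 1 ≠ 0 := by
    have := Fintype.one_lt_card (α := F)
    have : (1 : ℤ) < q := by rw [hq]; exact_mod_cast this
    omega
  -- The q² pairs split as M 0 + (q - 1) * M 1, and q - 1 can be cancelled.
  have hM1 : M 1 = q - e := by
    rw [Finset.sum_congr rfl fun s _ => hsplit s, Finset.sum_add_distrib] at hsum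
    simp [← hq] at hsum
    apply mul_left_cancel₀ hq1
    linear_combination hsum - h0
  change M s = _
  rw [hsplit s, hM1, h0]
  split_ifs <;> ring

lemma quadraticChar_neg_one_eq_sgn [DecidableEq F] (hp : p ≠ 2) (hF : Fintype.card F = p ^ m)
    (h2 : ringChar F ≠ 2) : quadraticChar F (-1) = sgn p m := by
  have hodd : p % 2 = 1 := Nat.odd_iff.mp ((Fact.out : p.Prime).odd_of_ne_two hp)
  rw [quadraticChar_neg_one h2, hF, Nat.cast_pow, map_pow, ZMod.χ₄_eq_neg_one_pow hodd,
    ← pow_mul, sgn]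
  congr 1
  obtain ⟨j, hj⟩ : ∃ j, p = 2 * j + 1 := ⟨p / 2, by omega⟩
  have h1 : p / 2 = j := by omega
  have h3 : (p - 1) * m = j * m * 2 := by rw [hj]; simp; ring
  rw [h1, h3, Nat.mul_div_cancel _ two_pos]

end Field

/-! ### Counting points over a prime field -/

section Count

variable {p : ℕ} [Fact p.Prime] {V : Type*} [Fintype V] [AddCommGroup V] [Module (ZMod p) V]

lemma card_mul_fiber (φ : V →ₗ[ZMod p] ZMod p) (hφ : φ ≠ 0) (ρ : ZMod p) :
    p * (Finset.univ.filter fun v => φ v = ρ).card = Fintype.card V := by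
  have hsurj : Function.Surjective φ := LinearMap.surjective hφ
  have heq : ∀ ρ', (Finset.univ.filter fun v => φ v = ρ').card =
      (Finset.univ.filter fun v => φ v = ρ).card := by
    intro ρ'
    obtain ⟨w, hw⟩ := hsurj (ρ - ρ')
    refine Finset.card_bij' (fun v _ => v + w) (fun v _ => v - w) ?_ ?_ ?_ ?_
    · intro v hv
      simp only [Finset.mem_filter, Finset.mem_univ, true_and] at hv ⊢
      rw [map_add, hv, hw]; ring
    · intro v hv
      simp only [Finset.mem_filter, Finset.mem_univ, true_and] at hv ⊢
      rw [map_sub, hv, hw]; ring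
    · intro v _; simp
    · intro v _; simp
  have := Finset.card_eq_sum_card_fiberwise (f := φ) (s := Finset.univ) (t := Finset.univ)
    (fun _ _ => Finset.mem_univ _)
  rw [Finset.sum_congr rfl fun ρ' _ => heq ρ'] at this
  simpa [ZMod.card] using this.symm

/-- Counting the points of a quadric on a hyperplane by means of the translates along `w`. -/
lemma sum_card_along_line (Q : V → ZMod p) (φ : V → ZMod p) (w : V)
    (h : ∀ v (ν : ZMod p), Q (v + ν • w) = Q v + ν * φ v + ν ^ 2 * Q w) (c ρ : ZMod p) :
    (∑ ν : ZMod p, ((Finset.univ.filter fun v => Q v = c + ν * ρ + ν ^ 2 * Q w).card : ℤ)) =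
      p * (Finset.univ.filter fun v => Q v = c ∧ φ v = ρ).card
        + (Fintype.card V - (Finset.univ.filter fun v => φ v = ρ).card) := by
  -- Translation by ν • w cancels the term quadratic in ν.
  have hshift : ∀ ν : ZMod p, (Finset.univ.filter fun v => Q v = c + ν * ρ + ν ^ 2 * Q w).card =
      (Finset.univ.filter fun v => Q v + ν * φ v = c + ν * ρ).card := by
    intro ν
    symm
    refine Finset.card_equiv (Equiv.addRight (ν • w)) fun v => ?_
    simp only [Finset.mem_filter, Finset.mem_univ, true_and, Equiv.coe_addRight, h]
    exact (add_left_inj _).symm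
  -- For fixed v the condition is affine in ν. If φ v = ρ it holds for all ν or for none, according
  -- to whether Q v = c; otherwise it holds for exactly one ν.
  have hv : ∀ v, ((∑ ν : ZMod p, if Q v + ν * φ v = c + ν * ρ then 1 else 0 : ℤ)) =
      p * (if Q v = c ∧ φ v = ρ then 1 else 0) + (1 - if φ v = ρ then 1 else 0) := by
    intro v
    by_cases h1 : φ v = ρ
    · by_cases h2 : Q v = c <;> simp [h1, h2, ZMod.card]
    · have h3 : φ v - ρ ≠ 0 := sub_ne_zero.mpr h1
      have : ∀ ν : ZMod p, Q v + ν * φ v = c + ν * ρ ↔ ν = (c - Q v) / (φ v - ρ) := by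
        intro ν
        rw [eq_div_iff h3]
        constructor <;> intro h <;> linear_combination h
      simp [this, h1]
  simp only [hshift, Finset.card_filter]
  push_cast
  rw [Finset.sum_comm, Finset.sum_congr rfl fun v _ => hv v, Finset.sum_add_distrib,
    Finset.mul_sum, Finset.sum_sub_distrib]
  simp

/-- Completing the square: ν ↦ 2tν + ρ matches the roots with the square roots of the discriminant.
-/
lemma card_roots_of_ne_zero (hp : p ≠ 2) {t : ZMod p} (ht : t ≠ 0) (ρ c : ZMod p) :
    ((Finset.univ.filter fun ν : ZMod p => c + ν * ρ + ν ^ 2 * t = 0).card : ℤ) =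
      quadraticChar (ZMod p) (ρ ^ 2 - 4 * (t * c)) + 1 := by
  have h2' : ringChar (ZMod p) ≠ 2 := by rwa [ZMod.ringChar_zmod_n]
  have h2 : (2 : ZMod p) ≠ 0 := Ring.two_ne_zero h2'
  rw [← quadraticChar_card_sqrts h2', Set.toFinset_ofPred, Nat.cast_inj]
  have h4 : (4 * t : ZMod p) ≠ 0 := mul_ne_zero (by
    rw [show (4 : ZMod p) = 2 * 2 by norm_num]; exact mul_ne_zero h2 h2) ht
  refine Finset.card_bij' (fun ν _ => 2 * t * ν + ρ) (fun x _ => (x - ρ) / (2 * t)) ?_ ?_ ?_ ?_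
  · intro ν h
    simp only [Finset.mem_filter, Finset.mem_univ, true_and] at h ⊢
    linear_combination 4 * t * h
  · intro x h
    simp only [Finset.mem_filter, Finset.mem_univ, true_and] at h ⊢
    apply mul_left_cancel₀ h4
    field_simp
    linear_combination 4 * h
  · intro ν _
    field_simp
    ring
  · intro x _
    field_simp
    ring

end Count

/-! ### The trace form, its polar form and its level sets -/

section TraceForm

variable (p : ℕ) [Fact p.Prime] {F : Type*} [Field F] [Algebra (ZMod p) F] (k l : ℕ)

/-- The quadratic form `(x, y) ↦ Tr(x^{p^k+1} + y^{p^l+1})`. -/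
noncomputable def traceForm (z : F × F) : ZMod p :=
  Algebra.trace (ZMod p) F (z.1 ^ (p ^ k + 1) + z.2 ^ (p ^ l + 1))

/-- The linear functional `(x, y) ↦ Tr(ax + by)`. -/
noncomputable def traceFunctional (ab : F × F) : F × F →ₗ[ZMod p] ZMod p where
  toFun z := Algebra.trace (ZMod p) F (ab.1 * z.1 + ab.2 * z.2)
  map_add' z z' := by
    rw [← map_add]
    congr 1
    simp only [Prod.fst_add, Prod.snd_add]
    ring
  map_smul' r z := by
    simp only [Prod.smul_fst, Prod.smul_snd, RingHom.id_apply, mul_smul_comm, ← smul_add, map_smul]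

/-- The adjoint of the polar form of `x ↦ Tr(x^{p^k+1})` on a field with `p^m` elements. -/
def polarAdjoint (m : ℕ) (z : F) : F := z ^ p ^ k + z ^ p ^ (k * (m - 1))

/-- The adjoint of the polar form of `traceForm`, for the pairing `Tr(ax + by)`. -/
def adjointPair (m : ℕ) (z : F × F) : F × F := (polarAdjoint p k m z.1, polarAdjoint p l m z.2)

variable {p k l} [Fintype F] {m : ℕ}

lemma traceFunctional_ne_zero {ab : F × F} (h : ab ≠ 0) : traceFunctional p ab ≠ 0 := by
  intro h0
  apply h
  have key : ∀ z : F × F, Algebra.trace (ZMod p) F (ab.1 * z.1 + ab.2 * z.2) = 0 :=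
    fun z => LinearMap.congr_fun h0 z
  have nd : ∀ a : F, (∀ b, Algebra.trace (ZMod p) F (a * b) = 0) → a = 0 := by
    exact (traceForm_nondegenerate (ZMod p) F).1
  ext
  · exact nd _ fun b => by simpa using key (b, 0)
  · exact nd _ fun b => by simpa using key (0, b)

lemma trace_pow_p_pow (j : ℕ) (x : F) :
    Algebra.trace (ZMod p) F (x ^ p ^ j) = Algebra.trace (ZMod p) F x := by
  induction j with
  | zero => simp
  | succ j ih =>
    rw [pow_succ, pow_mul, ← ih,
      ← Algebra.trace_eq_of_algEquiv (FiniteField.frobeniusAlgEquivOfAlgebraic (ZMod p) F)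
        (x ^ p ^ j)]
    simp [ZMod.card]

/-- This makes z ↦ z^{p^{k(m-1)}} the inverse of z ↦ z^{p^k}, with no truncated subtraction of k
from m. -/
lemma dvd_adjoint_exponent (hm : 0 < m) (k : ℕ) : m ∣ k + k * (m - 1) := by
  obtain ⟨m, rfl⟩ : ∃ n, m = n + 1 := ⟨m - 1, by omega⟩
  exact ⟨k, by simp; ring⟩

/-- The trace is Frobenius invariant, so the adjoint of a Frobenius power is its inverse. -/
lemma trace_pow_mul (hm : 0 < m) (hF : Fintype.card F = p ^ m) (x z : F) :
    Algebra.trace (ZMod p) F (x ^ p ^ k * z) =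
      Algebra.trace (ZMod p) F (x * z ^ p ^ (k * (m - 1))) := by
  rw [← trace_pow_p_pow (k * (m - 1)) (x ^ p ^ k * z), mul_pow, ← pow_mul, ← pow_add,
    pow_p_pow_of_dvd hF (dvd_adjoint_exponent hm k)]

lemma trace_pow_add (hm : 0 < m) (hF : Fintype.card F = p ^ m) (x z : F) (ν : ZMod p) :
    Algebra.trace (ZMod p) F ((x + ν • z) ^ (p ^ k + 1)) =
      Algebra.trace (ZMod p) F (x ^ (p ^ k + 1)) +
        ν * Algebra.trace (ZMod p) F (polarAdjoint p k m z * x) +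
        ν ^ 2 * Algebra.trace (ZMod p) F (z ^ (p ^ k + 1)) := by
  have : CharP F p := charP_of_injective_algebraMap (algebraMap (ZMod p) F).injective p
  -- Frobenius is additive and fixes ν in 𝔽_p, so the power is a product of two factors affine in ν.
  -- The two cross terms merge into `polarAdjoint` under the trace.
  have h1 : (x + ν • z) ^ (p ^ k + 1) =
      x ^ (p ^ k + 1) + ν • (z ^ p ^ k * x) + ν • (x ^ p ^ k * z) + ν ^ 2 • z ^ (p ^ k + 1) := by
    rw [pow_succ, add_pow_char_pow, smul_pow, ZMod.pow_card_pow]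
    simp only [Algebra.smul_def, map_pow]
    ring
  rw [h1]
  simp only [map_add, map_smul, smul_eq_mul, polarAdjoint, add_mul]
  rw [trace_pow_mul hm hF x z, mul_comm x]
  ring

lemma traceForm_add_smul (hm : 0 < m) (hF : Fintype.card F = p ^ m) (w v : F × F) (ν : ZMod p) :
    traceForm p k l (v + ν • w) = traceForm p k l v +
      ν * traceFunctional p (adjointPair p k l m w) v +
      ν ^ 2 * traceForm p k l w := by
  simp only [traceForm, traceFunctional, adjointPair, LinearMap.coe_mk, AddHom.coe_mk, map_add, Prod.fst_add,
    Prod.snd_add, Prod.smul_fst, Prod.smul_snd, trace_pow_add hm hF]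
  ring

/-- Nondegeneracy of the polar form. The map is additive, and raising the equation for a kernel
element d to the power p^k yields d^{p^{2k}} = -d, which forces d = 0. -/
lemma polarAdjoint_bijective (hp : p ≠ 2) (hm : 0 < m) (hF : Fintype.card F = p ^ m) {r : ℕ}
    (hr : Odd r) (hd : m ∣ k * r) :
    Function.Bijective (polarAdjoint p k m : F → F) := by
  have : CharP F p := charP_of_injective_algebraMap (algebraMap (ZMod p) F).injective p
  rw [← Finite.injective_iff_bijective]
  intro x y hxy
  rw [← sub_eq_zero]
  refine eq_zero_of_pow_eq_neg hp hF hr hd ?_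
  have h1 : (x - y) ^ p ^ k + (x - y) ^ p ^ (k * (m - 1)) = 0 := by
    simp only [polarAdjoint] at hxy
    rw [sub_pow_char_pow, sub_pow_char_pow]
    linear_combination hxy
  have h2 := congrArg (· ^ p ^ k) h1
  simp only [add_pow_char_pow, ← pow_mul, ← pow_add] at h2
  rw [add_comm (k * (m - 1)), pow_p_pow_of_dvd hF (dvd_adjoint_exponent hm k),
    zero_pow (pow_ne_zero _ (Fact.out : p.Prime).ne_zero)] at h2
  rw [two_mul]
  exact eq_neg_of_add_eq_zero_left h2

lemma adjointPair_bijective (hp : p ≠ 2) (hm : 0 < m) (hF : Fintype.card F = p ^ m) {r r' : ℕ}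
    (hr : Odd r) (hd : m ∣ k * r) (hr' : Odd r') (hd' : m ∣ l * r') :
    Function.Bijective (adjointPair p k l m : F × F → F × F) :=
  (polarAdjoint_bijective hp hm hF hr hd).prodMap (polarAdjoint_bijective hp hm hF hr' hd')

lemma adjointPair_zero {K : Type*} [Field K] : adjointPair p k l m (0 : K × K) = 0 := by
  have h : p ≠ 0 := (Fact.out : p.Prime).ne_zero
  simp [adjointPair, polarAdjoint, h]

/-- The number of points of the quadrics `Tr(x^{p^k+1} + y^{p^l+1}) = t`. -/
lemma card_traceForm_eq [DecidableEq F] (hp : p ≠ 2) (hm : 0 < m) (hF : Fintype.card F = p ^ m)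
    {r r' : ℕ} (hr : Odd r) (hd : m ∣ k * r) (hr' : Odd r') (hd' : m ∣ l * r') (t : ZMod p) :
    ((Finset.univ.filter fun z : F × F => traceForm p k l z = t).card : ℤ) =
      (p : ℤ) ^ (2 * m - 1) - sgn p m * (p : ℤ) ^ (m - 1)
        + if t = 0 then sgn p m * (p : ℤ) ^ m else 0 := by
  have : CharP F p := charP_of_injective_algebraMap (algebraMap (ZMod p) F).injective p
  have h2 : ringChar F ≠ 2 := by rwa [ringChar.eq F p]
  -- Both counts are convolutions of one-variable fibre sizes, and these agree factor by factor.
  have hfib : ∀ s : F,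
      (Finset.univ.filter fun z : F × F => z.1 ^ (p ^ k + 1) + z.2 ^ (p ^ l + 1) = s).card =
        (Finset.univ.filter fun z : F × F => z.1 ^ 2 + z.2 ^ 2 = s).card := by
    intro s
    have conv : ∀ n n' : ℕ, (Finset.univ.filter fun z : F × F => z.1 ^ n + z.2 ^ n' = s).card =
        ∑ a : F, (Finset.univ.filter fun x : F => x ^ n = a).card *
          (Finset.univ.filter fun x : F => x ^ n' = s - a).card := by
      intro n n'
      rw [Finset.card_eq_sum_card_fiberwise (f := fun z : F × F => z.1 ^ n) (t := Finset.univ)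
        (fun _ _ => Finset.mem_univ _)]
      refine Finset.sum_congr rfl fun a _ => ?_
      rw [← Finset.card_product]
      congr 1
      ext z
      simp only [Finset.mem_filter, Finset.mem_univ, true_and, Finset.mem_product]
      constructor
      · rintro ⟨h, h'⟩
        exact ⟨h', by rw [← h, h']; ring⟩
      · rintro ⟨h, h'⟩
        exact ⟨by rw [h, h']; ring, h⟩
    rw [conv, conv]
    refine Finset.sum_congr rfl fun a _ => ?_
    rw [card_pow_fiber_eq hp hF hr hd, card_pow_fiber_eq hp hF hr' hd']
  have htr : (Algebra.trace (ZMod p) F) ≠ 0 := Algebra.trace_ne_zero (ZMod p) F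
  have hT : ((Finset.univ.filter fun s : F => Algebra.trace (ZMod p) F s = t).card : ℤ) =
      (p : ℤ) ^ (m - 1) := by
    have h := card_mul_fiber (Algebra.trace (ZMod p) F) htr t
    rw [hF, ← mul_pow_sub_one hm.ne'] at h
    exact_mod_cast Nat.eq_of_mul_eq_mul_left (Fact.out : p.Prime).pos h
  rw [Finset.card_eq_sum_card_fiberwise (f := fun z : F × F => z.1 ^ (p ^ k + 1) + z.2 ^ (p ^ l + 1))
    (t := Finset.univ.filter fun s : F => Algebra.trace (ZMod p) F s = t)
    (fun z hz => by simpa [traceForm] using hz)]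
  have hin : ∀ s ∈ Finset.univ.filter (fun s : F => Algebra.trace (ZMod p) F s = t),
      (((Finset.univ.filter fun z : F × F => traceForm p k l z = t).filter
        fun z => z.1 ^ (p ^ k + 1) + z.2 ^ (p ^ l + 1) = s).card : ℤ) =
        ((p : ℤ) ^ m - sgn p m) + if s = 0 then sgn p m * (p : ℤ) ^ m else 0 := by
    intro s hs
    have : ((Finset.univ.filter fun z : F × F => traceForm p k l z = t).filter
        fun z => z.1 ^ (p ^ k + 1) + z.2 ^ (p ^ l + 1) = s) =
        Finset.univ.filter fun z : F × F => z.1 ^ (p ^ k + 1) + z.2 ^ (p ^ l + 1) = s := by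
      ext z
      simp only [Finset.mem_filter, Finset.mem_univ, true_and] at hs ⊢
      exact ⟨fun h => h.2, fun h => ⟨(congrArg _ h).trans hs, h⟩⟩
    rw [this, hfib, card_sq_add_sq h2, quadraticChar_neg_one_eq_sgn hp hF h2, hF]
    push_cast
    rfl
  rw [Nat.cast_sum, Finset.sum_congr rfl hin, Finset.sum_add_distrib, Finset.sum_const,
    Finset.sum_ite_eq', nsmul_eq_mul, hT]
  -- Only s = 0 has an exceptional number of representations, and it has trace t exactly when t = 0.
  have h0 : (0 : F) ∈ Finset.univ.filter (fun s : F => Algebra.trace (ZMod p) F s = t) ↔ t = 0 := by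
    simp [eq_comm]
  simp only [h0]
  congr 1
  obtain ⟨n, rfl⟩ : ∃ n, m = n + 1 := ⟨m - 1, by omega⟩
  rw [show 2 * (n + 1) - 1 = n + (n + 1) by omega, Nat.add_sub_cancel, pow_add]
  ring

/-- The number of points of a quadric on an affine hyperplane. -/
lemma card_traceForm_eq_and_functional_eq [DecidableEq F] (hp : p ≠ 2) (hm : 0 < m)
    (hF : Fintype.card F = p ^ m) {r r' : ℕ} (hr : Odd r) (hd : m ∣ k * r) (hr' : Odd r')
    (hd' : m ∣ l * r') {w : F × F}
    (hw : adjointPair p k l m w ≠ 0) (c ρ : ZMod p) :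
    ((Finset.univ.filter fun z : F × F => traceForm p k l z = c ∧
      traceFunctional p (adjointPair p k l m w) z = ρ).card : ℤ) =
      (p : ℤ) ^ (2 * m - 2) + sgn p m * (p : ℤ) ^ (m - 1) *
        ((Finset.univ.filter fun ν : ZMod p =>
          c + ν * ρ + ν ^ 2 * traceForm p k l w = 0).card - 1) := by
  have h1 := sum_card_along_line (traceForm p k l)
    (traceFunctional p (adjointPair p k l m w)) w
    (traceForm_add_smul hm hF w) c ρ
  have h2 := card_mul_fiber _ (traceFunctional_ne_zero (p := p) hw) ρ
  rw [Fintype.card_prod, hF] at h1 h2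
  zify at h2
  simp only [card_traceForm_eq hp hm hF hr hd hr' hd'] at h1
  rw [Finset.sum_add_distrib, ← Finset.sum_filter, Finset.sum_const, Finset.sum_const] at h1
  simp only [Finset.card_univ, ZMod.card, nsmul_eq_mul] at h1
  push_cast at h1
  obtain ⟨n, rfl⟩ : ∃ n, m = n + 1 := ⟨m - 1, by omega⟩
  rw [show 2 * (n + 1) - 1 = 2 * n + 1 by omega, Nat.add_sub_cancel] at h1
  rw [show 2 * (n + 1) - 2 = 2 * n by omega, Nat.add_sub_cancel]
  have hp0 : (p : ℤ) ≠ 0 := by exact_mod_cast (Fact.out : p.Prime).ne_zero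
  -- One factor p clears the coefficient of the wanted count in `h1`; the other lets `h2` eliminate
  -- the size of the hyperplane.
  apply mul_left_cancel₀ (mul_ne_zero hp0 hp0)
  linear_combination (-(p : ℤ)) * h1 + h2

end TraceForm

/-! ### Enumerators of linear codes and sums over powers of a generator -/

section Codes

variable {p : ℕ} [Fact p.Prime] {ι : Type*} [Fintype ι]

lemma hammingNorm_add_symbolCount_zero (w : ι → ZMod p) :
    hammingNorm w + symbolCount w 0 = Fintype.card ι := by
  rw [add_comm, hammingNorm, symbolCount]
  exact Finset.card_filter_add_card_filter_not _

open Classical in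
lemma weightCount_eq_card (C : Submodule (ZMod p) (ι → ZMod p)) (i : ℕ) :
    weightCount C i =
      ((Finset.univ.filter fun w : ι → ZMod p => w ∈ C).filter fun w => hammingNorm w = i).card := by
  rw [weightCount, Nat.card_eq_fintype_card, Fintype.card_subtype, Finset.filter_filter]

open Classical in
lemma weightEnumerator_eq_sum (C : Submodule (ZMod p) (ι → ZMod p)) :
    weightEnumerator C = ∑ w ∈ Finset.univ.filter (fun w : ι → ZMod p => w ∈ C),
      (Polynomial.X : Polynomial ℤ) ^ hammingNorm w := by
  rw [weightEnumerator, ← Finset.sum_fiberwise_of_maps_to (g := fun w => hammingNorm w)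
    (t := Finset.range (Fintype.card ι + 1))
    (fun w _ => Finset.mem_range.mpr (Nat.lt_succ_of_le hammingNorm_le_card_fintype))]
  refine Finset.sum_congr rfl fun i _ => ?_
  rw [weightCount_eq_card, Finset.sum_congr rfl (g := fun _ => (Polynomial.X : Polynomial ℤ) ^ i)
    (fun w hw => by rw [(Finset.mem_filter.mp hw).2]), Finset.sum_const, nsmul_eq_mul]
  simp

lemma weightCount_eq_zero_of_lt (C : Submodule (ZMod p) (ι → ZMod p)) {i : ℕ}
    (hi : Fintype.card ι < i) : weightCount C i = 0 := by
  rw [weightCount_eq_card, Finset.card_eq_zero, Finset.filter_eq_empty_iff]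
  rintro w _ rfl
  exact absurd hammingNorm_le_card_fintype (not_le.mpr hi)

lemma coeff_weightEnumerator (C : Submodule (ZMod p) (ι → ZMod p)) (i : ℕ) :
    (weightEnumerator C).coeff i = weightCount C i := by
  rw [weightEnumerator]
  simp only [Polynomial.finsetSum_coeff, Polynomial.coeff_C_mul, Polynomial.coeff_X_pow, mul_ite,
    mul_one, mul_zero, Finset.sum_ite_eq, Finset.mem_range]
  split_ifs with h
  · rfl
  · rw [weightCount_eq_zero_of_lt C (by omega), Nat.cast_zero]

lemma isWeightCode_two_of_weightEnumerator {C : Submodule (ZMod p) (ι → ZMod p)} {a b : ℤ}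
    {i j : ℕ} (h : weightEnumerator C =
      1 + Polynomial.C a * Polynomial.X ^ i + Polynomial.C b * Polynomial.X ^ j)
    (ha : a ≠ 0) (hb : b ≠ 0) (hi : i ≠ 0) (hj : j ≠ 0) (hij : i ≠ j) : IsWeightCode 2 C := by
  rw [IsWeightCode, ← Set.ncard_pair hij]
  congr 1
  ext n
  have hn : (weightCount C n : ℤ) =
      (if n = 0 then 1 else 0) + (if n = i then a else 0) + if n = j then b else 0 := by
    rw [← coeff_weightEnumerator, h]
    simp [Polynomial.coeff_X_pow, Polynomial.coeff_one]
  -- The upper bound in the definition of a two-weight code is automatic, so i and j need no bound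
  -- by the length.
  have hle : weightCount C n ≠ 0 → n ≤ Fintype.card ι := fun h0 => by
    by_contra hlt
    exact h0 (weightCount_eq_zero_of_lt C (not_le.mp hlt))
  simp only [Set.mem_ofPred_eq, Set.mem_insert_iff, Set.mem_singleton_iff]
  constructor
  · rintro ⟨h1, -, h3⟩
    by_contra hne
    push Not at hne
    rw [if_neg (by omega), if_neg hne.1, if_neg hne.2] at hn
    simp at hn
    exact h3 hn
  · intro hor
    have hne : weightCount C n ≠ 0 := by
      rcases hor with rfl | rfl
      · rw [if_neg hi, if_neg hij] at hn
        intro h0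
        rw [h0] at hn
        simp at hn
        exact ha hn.symm
      · rw [if_neg hj, if_neg hij.symm] at hn
        intro h0
        rw [h0] at hn
        simp at hn
        exact hb hn.symm
    refine ⟨?_, hle hne, hne⟩
    rcases hor with rfl | rfl <;> omega

lemma prod_X_pow_split (e : ZMod p → ℕ) :
    (∏ ρ : ZMod p, (MvPolynomial.X ρ : MvPolynomial (ZMod p) ℤ) ^ e ρ) =
      MvPolynomial.X 0 ^ e 0 *
        ∏ ρ ∈ Finset.univ.filter (fun ρ : ZMod p => ρ ≠ 0), MvPolynomial.X ρ ^ e ρ := by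
  rw [← Finset.mul_prod_erase Finset.univ _ (Finset.mem_univ (0 : ZMod p)), Finset.filter_ne']

/-- Shifting by g² lets the exponents run over 2, …, p, and these pair off as 2j, 2j + 1 with j from
1 to (p - 1) / 2. -/
lemma sum_units_eq_sum_pow {R : Type*} [AddCommMonoid R] {g : (ZMod p)ˣ} (hp : p ≠ 2)
    (hg : ∀ x : (ZMod p)ˣ, x ∈ Subgroup.zpowers g) (h : ZMod p → R) :
    (∑ s ∈ Finset.univ.filter (fun s : ZMod p => s ≠ 0), h s) =
      ∑ j ∈ Finset.Icc 1 ((p - 1) / 2),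
        (h ((g : ZMod p) ^ (2 * j)) + h ((g : ZMod p) ^ (2 * j + 1))) := by
  have hodd : Odd p := (Fact.out : p.Prime).odd_of_ne_two hp
  have h1 : (∑ s ∈ Finset.univ.filter (fun s : ZMod p => s ≠ 0), h s) =
      ∑ u : (ZMod p)ˣ, h u := by
    symm
    refine Finset.sum_bij (fun u _ => (u : ZMod p)) ?_ ?_ ?_ ?_
    · intro u _; simp
    · intro u _ v _ huv; exact Units.ext huv
    · intro s hs
      exact ⟨Units.mk0 s (by simpa using hs), Finset.mem_univ _, rfl⟩
    · intro u _; rfl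
  have h2 : (∑ u : (ZMod p)ˣ, h u) = ∑ u : (ZMod p)ˣ, h (u * g ^ 2 : (ZMod p)ˣ) :=
    (Equiv.sum_comp (Equiv.mulRight (g ^ 2)) fun u : (ZMod p)ˣ => h u).symm
  have hord : orderOf g = p - 1 := by
    rw [orderOf_eq_card_of_forall_mem_zpowers hg, Nat.card_eq_fintype_card, ZMod.card_units]
  have h3 : (∑ u : (ZMod p)ˣ, h (u * g ^ 2 : (ZMod p)ˣ)) =
      ∑ i ∈ Finset.range (p - 1), h ((g : ZMod p) ^ (i + 2)) := by
    rw [← IsCyclic.image_range_orderOf hg, hord, Finset.sum_image]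
    · simp [pow_add]
    · rw [← hord]
      intro a ha b hb hab
      exact pow_injOn_Iio_orderOf (by simpa using ha) (by simpa using hb) hab
  have h4 : ∀ n : ℕ, (∑ i ∈ Finset.range (2 * n), h ((g : ZMod p) ^ (i + 2))) =
      ∑ j ∈ Finset.Icc 1 n, (h ((g : ZMod p) ^ (2 * j)) + h ((g : ZMod p) ^ (2 * j + 1))) := by
    intro n
    induction n with
    | zero => simp
    | succ n ih =>
      rw [Finset.sum_Icc_succ_top (by omega), ← ih, mul_add, mul_one, Finset.sum_range_succ,
        Finset.sum_range_succ, add_assoc]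
  rw [h1, h2, h3, ← h4]
  obtain ⟨j, hj⟩ := hodd
  congr 2
  omega

/-- If the generator were a square, every unit would be one, but a nonsquare exists in odd
characteristic. -/
lemma quadraticChar_generator {g : (ZMod p)ˣ} (hp : p ≠ 2)
    (hg : ∀ x : (ZMod p)ˣ, x ∈ Subgroup.zpowers g) : quadraticChar (ZMod p) (g : ZMod p) = -1 := by
  rcases quadraticChar_dichotomy (F := ZMod p) g.ne_zero with h | h
  · exfalso
    obtain ⟨a, ha⟩ := FiniteField.exists_nonsquare (F := ZMod p) (by rwa [ZMod.ringChar_zmod_n])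
    have ha0 : a ≠ 0 := by rintro rfl; exact ha (IsSquare.zero)
    obtain ⟨n, hn⟩ := hg (Units.mk0 a ha0)
    obtain ⟨b, hb⟩ := (quadraticChar_one_iff_isSquare g.ne_zero).mp h
    apply ha
    refine ⟨b ^ n, ?_⟩
    have := congrArg Units.val hn
    simp only [Units.val_mk0] at this
    rw [← this, ← mul_zpow, ← hb]
    simp
  · exact h

end Codes

/-- Since p - 1 is even, the exponent is additive in m, and the sign for m = 1 is η(-1). So ε' = ε
η(-1). -/
lemma sgn_add_one {p : ℕ} [Fact p.Prime] (hp : p ≠ 2) (m : ℕ) :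
    sgn p (m + 1) = sgn p m * quadraticChar (ZMod p) (-1) := by
  have h1 : quadraticChar (ZMod p) (-1) = sgn p 1 :=
    quadraticChar_neg_one_eq_sgn (m := 1) hp (by simp [ZMod.card]) (by rwa [ZMod.ringChar_zmod_n])
  obtain ⟨j, hj⟩ : Odd p := (Fact.out : p.Prime).odd_of_ne_two hp
  have key : ∀ n, (p - 1) * n / 2 = j * n := fun n => by
    rw [hj, Nat.add_sub_cancel, mul_assoc, Nat.mul_div_cancel_left _ two_pos]
  rw [h1, sgn, sgn, sgn, key, key, key, ← pow_add, mul_add]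

lemma sgn_eq_one_or_neg_one (p m : ℕ) : sgn p m = 1 ∨ sgn p m = -1 := neg_one_pow_eq_or _ _

/-! ### Codewords parametrized through the polar form -/

section TraceCode

variable {p : ℕ} [Fact p.Prime] {F : Type*} [Field F] [Algebra (ZMod p) F]
  {k l m : ℕ}

lemma symbolCount_codeword (D : Finset (F × F)) (ab : F × F) (ρ : ZMod p) :
    symbolCount (codeword p D ab) ρ = (D.filter fun z => traceFunctional p ab z = ρ).card := by
  classical
  rw [symbolCount]
  refine Finset.card_bij (fun d _ => (d : F × F)) ?_ ?_ ?_
  · intro d hd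
    simp only [Finset.mem_filter, Finset.mem_univ, true_and] at hd
    exact Finset.mem_filter.mpr ⟨d.2, hd⟩
  · intro a _ b _ h
    exact Subtype.ext h
  · intro z hz
    obtain ⟨h1, h2⟩ := Finset.mem_filter.mp hz
    exact ⟨⟨z, h1⟩, Finset.mem_filter.mpr ⟨Finset.mem_univ _, h2⟩, rfl⟩

lemma traceForm_zero : traceForm p k l (0 : F × F) = 0 := by
  simp [traceForm]

variable [Fintype F]

lemma sum_traceCode {R : Type*} [AddCommMonoid R] {D : Finset (F × F)}
    {_ : Fintype (D → ZMod p)} {_ : DecidablePred (· ∈ traceCode p D)}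
    (hinj : Function.Injective (codeword p D)) (f : (D → ZMod p) → R) :
    (∑ w ∈ Finset.univ.filter (fun w : D → ZMod p => w ∈ traceCode p D), f w) =
      ∑ ab : F × F, f (codeword p D ab) := by
  symm
  refine Finset.sum_bij (fun ab _ => codeword p D ab) ?_ ?_ ?_ ?_
  · intro ab _
    exact Finset.mem_filter.mpr ⟨Finset.mem_univ _, LinearMap.mem_range_self _ _⟩
  · intro a _ b _ h
    exact hinj h
  · intro w hw
    obtain ⟨ab, hab⟩ := (Finset.mem_filter.mp hw).2
    exact ⟨ab, Finset.mem_univ _, hab⟩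
  · intro _ _; rfl

lemma finrank_traceCode (hF : Fintype.card F = p ^ m) {D : Finset (F × F)}
    (hinj : Function.Injective (codeword p D)) :
    Module.finrank (ZMod p) (traceCode p D) = 2 * m := by
  have hF' : Module.finrank (ZMod p) F = m := by
    have h := Module.card_eq_pow_finrank (K := ZMod p) (V := F)
    rw [hF, ZMod.card] at h
    exact (Nat.pow_right_injective (Fact.out : p.Prime).two_le h).symm
  rw [traceCode, LinearMap.finrank_range_of_inj hinj, Module.finrank_prod, hF', two_mul]

variable [DecidableEq F]

lemma definingSet_eq (c : ZMod p) : definingSet p F k l c =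
    (Finset.univ.filter fun z : F × F => traceForm p k l z = c).erase 0 := by
  ext z
  simp [definingSet, traceForm, Prod.ext_iff]

/-- The form vanishes at the origin, so excluding the origin costs a point only when c = 0 and P
holds there. -/
lemma card_filter_definingSet (P : F × F → Prop) [DecidablePred P] (c : ZMod p) :
    (((definingSet p F k l c).filter P).card : ℤ) =
      (Finset.univ.filter fun z : F × F => traceForm p k l z = c ∧ P z).card -
        if c = 0 ∧ P 0 then 1 else 0 := by
  rw [definingSet_eq, Finset.filter_erase, Finset.filter_filter]
  split_ifs with h
  · have h0 : (0 : F × F) ∈ Finset.univ.filter fun z : F × F => traceForm p k l z = c ∧ P z := by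
      simp [traceForm_zero, h.1, h.2]
    rw [Finset.card_erase_of_mem h0, Nat.cast_sub (Finset.card_pos.mpr ⟨0, h0⟩), Nat.cast_one]
  · have h0 : (0 : F × F) ∉ Finset.univ.filter fun z : F × F => traceForm p k l z = c ∧ P z := by
      simpa [traceForm_zero, eq_comm] using h
    rw [Finset.erase_eq_of_notMem h0, sub_zero]

variable (hp : p ≠ 2) (hm : 0 < m) (hF : Fintype.card F = p ^ m) {r r' : ℕ}
  (hr : Odd r) (hd : m ∣ k * r) (hr' : Odd r') (hd' : m ∣ l * r')
include hp hm hF hr hd hr' hd'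

lemma card_definingSet (c : ZMod p) : ((definingSet p F k l c).card : ℤ) =
    (p : ℤ) ^ (2 * m - 1) - sgn p m * (p : ℤ) ^ (m - 1)
        + if c = 0 then sgn p m * (p : ℤ) ^ m - 1 else 0 := by
  have h := card_filter_definingSet (k := k) (l := l) (fun _ : F × F => True) c
  simp only [Finset.filter_true, and_true] at h
  rw [h, card_traceForm_eq hp hm hF hr hd hr' hd']
  split_ifs <;> ring

lemma symbolCount_codeword_adjointPair {w : F × F} (hw : w ≠ 0) (c ρ : ZMod p) :
    (symbolCount (codeword p (definingSet p F k l c) (adjointPair p k l m w)) ρ : ℤ) =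
      (p : ℤ) ^ (2 * m - 2) + sgn p m * (p : ℤ) ^ (m - 1) *
        ((Finset.univ.filter fun ν : ZMod p =>
          c + ν * ρ + ν ^ 2 * traceForm p k l w = 0).card - 1) - if c = 0 ∧ ρ = 0 then 1 else 0 := by
  have hw' : adjointPair p k l m w ≠ 0 := by
    rw [← adjointPair_zero (p := p) (k := k) (l := l) (m := m)]
    exact (adjointPair_bijective hp hm hF hr hd hr' hd').1.ne hw
  rw [symbolCount_codeword, card_filter_definingSet _,
    card_traceForm_eq_and_functional_eq hp hm hF hr hd hr' hd' hw', map_zero]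
  simp only [eq_comm (a := ρ)]

/-- Sums over the plane of functions that depend only on the value of the quadratic form, away
from the origin. -/
lemma sum_traceForm {R : Type*} [CommRing R] (G : F × F → R) (g : ZMod p → R)
    (hG : ∀ w, w ≠ 0 → G w = g (traceForm p k l w)) :
    ∑ w, G w = G 0 +
      (((p : ℤ) ^ (2 * m - 1) + sgn p m * (p - 1) * (p : ℤ) ^ (m - 1) - 1 : ℤ) : R) * g 0 +
      (((p : ℤ) ^ (2 * m - 1) - sgn p m * (p : ℤ) ^ (m - 1) : ℤ) : R) *
        ∑ t ∈ Finset.univ.filter (fun t : ZMod p => t ≠ 0), g t := by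
  -- The correction at the origin is what later lowers the number of isotropic vectors by one.
  have h1 : ∑ w, G w = ∑ w : F × F, g (traceForm p k l w) + (G 0 - g 0) := by
    rw [← Finset.add_sum_erase Finset.univ G (Finset.mem_univ 0),
      ← Finset.add_sum_erase Finset.univ (fun w : F × F => g (traceForm p k l w))
        (Finset.mem_univ 0), traceForm_zero,
      Finset.sum_congr rfl fun w hw => hG w (Finset.ne_of_mem_erase hw)]
    ring
  have h2 : ∑ w : F × F, g (traceForm p k l w) =
      ∑ t : ZMod p, (((Finset.univ.filter fun z : F × F => traceForm p k l z = t).card : ℤ) : R) *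
        g t := by
    rw [← Finset.sum_fiberwise Finset.univ (fun w : F × F => traceForm p k l w)]
    refine Finset.sum_congr rfl fun t _ => ?_
    rw [Finset.sum_congr rfl (g := fun _ => g t)
      (fun w hw => by rw [(Finset.mem_filter.mp hw).2]), Finset.sum_const, nsmul_eq_mul,
      Int.cast_natCast]
  rw [h1, h2, ← Finset.add_sum_erase Finset.univ _ (Finset.mem_univ (0 : ZMod p)), Finset.filter_ne',
    Finset.mul_sum]
  simp only [card_traceForm_eq hp hm hF hr hd hr' hd']
  rw [Finset.sum_congr rfl (s₁ := Finset.univ.erase (0 : ZMod p)) (g := fun t =>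
    (((p : ℤ) ^ (2 * m - 1) - sgn p m * (p : ℤ) ^ (m - 1) : ℤ) : R) * g t)
    (fun t ht => by rw [if_neg (Finset.ne_of_mem_erase ht), add_zero])]
  rw [if_true, ← mul_pow_sub_one hm.ne' (p : ℤ)]
  push_cast
  ring

/-- Reindexing the pairs (a, b) by the bijection `adjointPair` makes the weight a function of the
value of the form at w. -/
lemma weightEnumerator_traceCode {c : ZMod p}
    (hinj : Function.Injective (codeword p (definingSet p F k l c))) {a : ZMod p → ℕ}
    (ha : ∀ w : F × F, w ≠ 0 → hammingNorm
      (codeword p (definingSet p F k l c) (adjointPair p k l m w)) = a (traceForm p k l w)) :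
    weightEnumerator (traceCode p (definingSet p F k l c)) = 1 +
      Polynomial.C ((p : ℤ) ^ (2 * m - 1) + sgn p m * (p - 1) * (p : ℤ) ^ (m - 1) - 1) *
        Polynomial.X ^ a 0 +
      Polynomial.C ((p : ℤ) ^ (2 * m - 1) - sgn p m * (p : ℤ) ^ (m - 1)) *
        ∑ t ∈ Finset.univ.filter (fun t : ZMod p => t ≠ 0), Polynomial.X ^ a t := by
  classical
  rw [weightEnumerator_eq_sum, sum_traceCode hinj,
    ← (adjointPair_bijective hp hm hF hr hd hr' hd').sum_comp,
    sum_traceForm hp hm hF hr hd hr' hd' _ (fun t => Polynomial.X ^ a t)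
      (fun w hw => by rw [ha w hw]), adjointPair_zero, map_zero]
  simp only [hammingNorm_zero, pow_zero, eq_intCast]

lemma completeWeightEnumerator_traceCode {c : ZMod p}
    (hinj : Function.Injective (codeword p (definingSet p F k l c))) {e : ZMod p → ZMod p → ℕ}
    (he : ∀ w : F × F, w ≠ 0 → ∀ ρ, symbolCount
      (codeword p (definingSet p F k l c) (adjointPair p k l m w)) ρ = e (traceForm p k l w) ρ) :
    completeWeightEnumerator (traceCode p (definingSet p F k l c)) =
      MvPolynomial.X 0 ^ (definingSet p F k l c).card +
      MvPolynomial.C ((p : ℤ) ^ (2 * m - 1) + sgn p m * (p - 1) * (p : ℤ) ^ (m - 1) - 1) *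
        (∏ ρ : ZMod p, MvPolynomial.X ρ ^ e 0 ρ) +
      MvPolynomial.C ((p : ℤ) ^ (2 * m - 1) - sgn p m * (p : ℤ) ^ (m - 1)) *
        ∑ t ∈ Finset.univ.filter (fun t : ZMod p => t ≠ 0),
          ∏ ρ : ZMod p, MvPolynomial.X ρ ^ e t ρ := by
  classical
  rw [completeWeightEnumerator, sum_traceCode hinj,
    ← (adjointPair_bijective hp hm hF hr hd hr' hd').sum_comp,
    sum_traceForm hp hm hF hr hd hr' hd' _ (fun t => ∏ ρ : ZMod p, MvPolynomial.X ρ ^ e t ρ)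
      (fun w hw => by simp only [he w hw]), adjointPair_zero, map_zero]
  -- The zero codeword contributes the pure power of the variable at 0.
  have h0 : ∀ ρ : ZMod p, symbolCount (0 : definingSet p F k l c → ZMod p) ρ =
      if ρ = 0 then (definingSet p F k l c).card else 0 := by
    intro ρ
    simp only [symbolCount, Pi.zero_apply, eq_comm (a := (0 : ZMod p))]
    split_ifs with h <;> simp [h]
  simp only [h0, pow_ite, pow_zero, Finset.prod_ite_eq', Finset.mem_univ, if_true, eq_intCast]

lemma codeword_injective {c : ZMod p}
    (h : ∀ w : F × F, w ≠ 0 → hammingNorm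
      (codeword p (definingSet p F k l c) (adjointPair p k l m w)) ≠ 0) :
    Function.Injective (codeword p (definingSet p F k l c)) := by
  rw [injective_iff_map_eq_zero]
  intro ab hab
  obtain ⟨w, rfl⟩ := (adjointPair_bijective hp hm hF hr hd hr' hd').2 ab
  by_contra hne
  refine h w ?_ (by rw [hab, hammingNorm_zero])
  rintro rfl
  exact hne adjointPair_zero

end TraceCode

/-! ### Estimates for p^{m-1} -/

section Arithmetic

variable {p m : ℕ} [Fact p.Prime]

omit [Fact p.Prime] in
lemma pow_two_mul_sub_one (hm : 0 < m) : (p : ℤ) ^ (2 * m - 1) = p * ((p : ℤ) ^ (m - 1)) ^ 2 := by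
  rw [← pow_mul, ← pow_succ']
  congr 1
  omega

omit [Fact p.Prime] in
lemma pow_two_mul_sub_two : (p : ℤ) ^ (2 * m - 2) = ((p : ℤ) ^ (m - 1)) ^ 2 := by
  rw [← pow_mul]
  congr 1
  omega

lemma three_le_of_ne_two (hp : p ≠ 2) : 3 ≤ p := by
  have := (Fact.out : p.Prime).two_le
  omega

lemma pow_sub_one_cases (hp : p ≠ 2) (hm : 0 < m) :
    (m = 1 ∧ (p : ℤ) ^ (m - 1) = 1) ∨ 3 ≤ (p : ℤ) ^ (m - 1) := by
  rcases Nat.lt_or_ge 1 m with h | h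
  · right
    have h3 : (3 : ℤ) ≤ p := by exact_mod_cast three_le_of_ne_two hp
    exact h3.trans (le_self_pow₀ (by omega) (by omega))
  · left
    obtain rfl : m = 1 := by omega
    simp

/-- Used to show P + ε > 0 when c = 0. This fails precisely for P = 1, ε = -1, that is, m = 1 and p
≡ 3 mod 4, the excluded case. -/
lemma sgn_eq_one_or_three_le (hp : p ≠ 2) (hm : 0 < m) (h : m = 1 → p % 4 = 1) :
    (sgn p m = 1 ∧ 1 ≤ (p : ℤ) ^ (m - 1)) ∨ 3 ≤ (p : ℤ) ^ (m - 1) := by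
  rcases pow_sub_one_cases hp hm with ⟨rfl, h1⟩ | h1
  · left
    refine ⟨?_, h1.ge⟩
    have h4 := h rfl
    exact Even.neg_one_pow ⟨p / 4, by omega⟩
  · exact Or.inr h1

/-- Used to show (p - 1)P - 2ε > 0 when c ≠ 0. This could fail only for p = 3, m = 1 and ε = 1, but
there ε = -1. -/
lemma five_le_or_three_le (hp : p ≠ 2) (hm : 0 < m) :
    (sgn p m = -1 ∧ 1 ≤ (p : ℤ) ^ (m - 1)) ∨ (5 ≤ p ∧ 1 ≤ (p : ℤ) ^ (m - 1)) ∨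
      3 ≤ (p : ℤ) ^ (m - 1) := by
  rcases pow_sub_one_cases hp hm with ⟨rfl, h1⟩ | h1
  · have h3 := three_le_of_ne_two hp
    obtain ⟨j, hj⟩ := (Fact.out : p.Prime).odd_of_ne_two hp
    rcases eq_or_ne p 3 with rfl | hne
    · exact Or.inl ⟨rfl, h1.ge⟩
    · exact Or.inr (Or.inl ⟨by omega, h1.ge⟩)
  · exact Or.inr (Or.inr h1)

end Arithmetic

/-! ### Symbol counts, and the case c = 0 -/

section Cases

variable {p : ℕ} [Fact p.Prime] {F : Type*} [Field F] [Algebra (ZMod p) F] [Fintype F]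
  {k l m : ℕ} [DecidableEq F] (hp : p ≠ 2) (hm : 0 < m) (hF : Fintype.card F = p ^ m) {r r' : ℕ}
  (hr : Odd r) (hd : m ∣ k * r) (hr' : Odd r') (hd' : m ∣ l * r')
include hp hm hF hr hd hr' hd'

lemma hammingNorm_codeword_add (c : ZMod p) (ab : F × F) :
    (hammingNorm (codeword p (definingSet p F k l c) ab) : ℤ) +
      symbolCount (codeword p (definingSet p F k l c) ab) 0 =
    p * ((p : ℤ) ^ (m - 1)) ^ 2 - sgn p m * (p : ℤ) ^ (m - 1)
        + if c = 0 then sgn p m * (p * (p : ℤ) ^ (m - 1)) - 1 else 0 := by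
  rw [mul_pow_sub_one hm.ne', ← pow_two_mul_sub_one hm,
    ← card_definingSet hp hm hF hr hd hr' hd' c]
  have h := hammingNorm_add_symbolCount_zero (codeword p (definingSet p F k l c) ab)
  rw [Fintype.card_coe] at h
  exact_mod_cast h

/-- The equation in ν degenerates to c + νρ = 0: one root if ρ ≠ 0, all p if ρ = c = 0, none if ρ =
0 ≠ c. -/
lemma symbolCount_isotropic {w : F × F} (hw : w ≠ 0) (ht : traceForm p k l w = 0) (c ρ : ZMod p) :
    (symbolCount (codeword p (definingSet p F k l c) (adjointPair p k l m w)) ρ : ℤ) =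
      ((p : ℤ) ^ (m - 1)) ^ 2 + if ρ = 0 then
        (if c = 0 then sgn p m * (p - 1) * (p : ℤ) ^ (m - 1) - 1 else -sgn p m * (p : ℤ) ^ (m - 1))
        else 0 := by
  rw [symbolCount_codeword_adjointPair hp hm hF hr hd hr' hd' hw, ht, pow_two_mul_sub_two]
  rcases eq_or_ne ρ 0 with rfl | hρ
  · by_cases hc : c = 0
    · simp [hc, ZMod.card]
      ring
    · simp [hc]
  · have : ∀ ν : ZMod p, c + ν * ρ + ν ^ 2 * 0 = 0 ↔ ν = -c / ρ := by
      intro ν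
      rw [eq_div_iff hρ]
      constructor <;> intro h <;> linear_combination h
    simp only [this, Finset.filter_eq', Finset.mem_univ, if_true, Finset.card_singleton]
    simp [hρ]

/-- The equation in ν is truly quadratic, so its number of roots minus one is the character of its
discriminant. -/
lemma symbolCount_anisotropic {w : F × F} (hw : w ≠ 0) (ht : traceForm p k l w ≠ 0)
    (c ρ : ZMod p) :
    (symbolCount (codeword p (definingSet p F k l c) (adjointPair p k l m w)) ρ : ℤ) =
      ((p : ℤ) ^ (m - 1)) ^ 2 + sgn p m * (p : ℤ) ^ (m - 1) *
        quadraticChar (ZMod p) (ρ ^ 2 - 4 * (traceForm p k l w * c)) -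
        if c = 0 ∧ ρ = 0 then 1 else 0 := by
  rw [symbolCount_codeword_adjointPair hp hm hF hr hd hr' hd' hw, card_roots_of_ne_zero hp ht,
    pow_two_mul_sub_two, add_sub_cancel_right]

lemma traceCode_zero (h1 : m = 1 → p % 4 = 1) :
    ((definingSet p F k l 0).card : ℤ) =
          (p : ℤ) ^ (2 * m - 1) + sgn p m * (p - 1) * (p : ℤ) ^ (m - 1) - 1 ∧
      Module.finrank (ZMod p) (traceCode p (definingSet p F k l 0)) = 2 * m ∧
      IsWeightCode 2 (traceCode p (definingSet p F k l 0)) ∧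
      weightEnumerator (traceCode p (definingSet p F k l 0)) =
        1 + Polynomial.C ((p : ℤ) ^ (2 * m - 1) + sgn p m * (p - 1) * (p : ℤ) ^ (m - 1) - 1) *
              Polynomial.X ^ ((p - 1) * p ^ (2 * m - 2))
          + Polynomial.C (((p : ℤ) - 1) *
                ((p : ℤ) ^ (2 * m - 1) - sgn p m * (p : ℤ) ^ (m - 1))) *
              Polynomial.X ^ (((p : ℤ) - 1) *
                ((p : ℤ) ^ (2 * m - 2) + sgn p m * (p : ℤ) ^ (m - 1))).toNat ∧
      completeWeightEnumerator (traceCode p (definingSet p F k l 0)) =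
        MvPolynomial.X 0 ^
            ((p : ℤ) ^ (2 * m - 1) + sgn p m * (p - 1) * (p : ℤ) ^ (m - 1) - 1).toNat
          + MvPolynomial.C
                ((p : ℤ) ^ (2 * m - 1) + sgn p m * (p - 1) * (p : ℤ) ^ (m - 1) - 1) *
              MvPolynomial.X 0 ^
                ((p : ℤ) ^ (2 * m - 2) + sgn p m * (p - 1) * (p : ℤ) ^ (m - 1) - 1).toNat *
              ∏ ρ ∈ Finset.univ.filter (fun ρ : ZMod p => ρ ≠ 0),
                MvPolynomial.X ρ ^ (p ^ (2 * m - 2))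
          + MvPolynomial.C (((p : ℤ) - 1) *
                ((p : ℤ) ^ (2 * m - 1) - sgn p m * (p : ℤ) ^ (m - 1))) *
              MvPolynomial.X 0 ^ ((p : ℤ) ^ (2 * m - 2) - 1).toNat *
              ∏ ρ ∈ Finset.univ.filter (fun ρ : ZMod p => ρ ≠ 0),
                MvPolynomial.X ρ ^
                  ((p : ℤ) ^ (2 * m - 2) + sgn p m * (p : ℤ) ^ (m - 1)).toNat := by
  have hn : ((definingSet p F k l 0).card : ℤ) =
      (p : ℤ) ^ (2 * m - 1) + sgn p m * (p - 1) * (p : ℤ) ^ (m - 1) - 1 := by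
    rw [card_definingSet hp hm hF hr hd hr' hd', if_pos rfl, ← mul_pow_sub_one hm.ne' (p : ℤ)]
    ring
  -- The symbol counts as a function of t = Q(w). For c = 0 and t ≠ 0 the discriminant is ρ², so t
  -- itself no longer matters.
  set e : ZMod p → ZMod p → ℕ := fun t ρ =>
    if t = 0 then
      if ρ = 0 then ((p : ℤ) ^ (2 * m - 2) + sgn p m * (p - 1) * (p : ℤ) ^ (m - 1) - 1).toNat
      else p ^ (2 * m - 2)
    else
      if ρ = 0 then ((p : ℤ) ^ (2 * m - 2) - 1).toNat
      else ((p : ℤ) ^ (2 * m - 2) + sgn p m * (p : ℤ) ^ (m - 1)).toNat with he_def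
  set a : ZMod p → ℕ := fun t => if t = 0 then (p - 1) * p ^ (2 * m - 2) else
    (((p : ℤ) - 1) * ((p : ℤ) ^ (2 * m - 2) + sgn p m * (p : ℤ) ^ (m - 1))).toNat with ha_def
  have hp1 : ((p - 1 : ℕ) : ℤ) = p - 1 := by
    rw [Nat.cast_sub (Fact.out : p.Prime).one_le, Nat.cast_one]
  have hsc : ∀ w : F × F, w ≠ 0 → ∀ ρ, symbolCount
      (codeword p (definingSet p F k l 0) (adjointPair p k l m w)) ρ = e (traceForm p k l w) ρ := by
    intro w hw ρ
    by_cases ht : traceForm p k l w = 0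
    · have h := symbolCount_isotropic hp hm hF hr hd hr' hd' hw ht 0 ρ
      rw [← pow_two_mul_sub_two] at h
      simp only [he_def, ht, if_true] at h ⊢
      split_ifs with hρ
      · rw [if_pos hρ] at h
        omega
      · rw [if_neg hρ, add_zero] at h
        exact_mod_cast h
    · have h := symbolCount_anisotropic hp hm hF hr hd hr' hd' hw ht 0 ρ
      rw [← pow_two_mul_sub_two] at h
      simp only [he_def, ht, if_false]
      split_ifs with hρ
      · subst hρ
        rw [if_pos ⟨rfl, rfl⟩, mul_zero, mul_zero, sub_zero, zero_pow two_ne_zero,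
          quadraticChar_zero, mul_zero, add_zero] at h
        omega
      · rw [mul_zero, mul_zero, sub_zero, quadraticChar_sq_one' hρ, mul_one,
          if_neg (fun h => hρ h.2), sub_zero] at h
        omega
  have hnorm : ∀ w : F × F, w ≠ 0 → hammingNorm
      (codeword p (definingSet p F k l 0) (adjointPair p k l m w)) = a (traceForm p k l w) := by
    intro w hw
    have h := hammingNorm_codeword_add hp hm hF hr hd hr' hd' 0 (adjointPair p k l m w)
    rw [if_pos rfl] at h
    by_cases ht : traceForm p k l w = 0
    · rw [symbolCount_isotropic hp hm hF hr hd hr' hd' hw ht 0 0, if_pos rfl, if_pos rfl] at h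
      simp only [ha_def, ht, if_true]
      zify
      rw [hp1, pow_two_mul_sub_two]
      linear_combination h
    · rw [symbolCount_anisotropic hp hm hF hr hd hr' hd' hw ht 0 0] at h
      simp only [ha_def, ht, if_false]
      have h' : ((p : ℤ) - 1) * ((p : ℤ) ^ (2 * m - 2) + sgn p m * (p : ℤ) ^ (m - 1)) =
          hammingNorm (codeword p (definingSet p F k l 0) (adjointPair p k l m w)) := by
        rw [pow_two_mul_sub_two]
        simp at h
        linear_combination -h
      rw [h', Int.toNat_natCast]
  have hp3 : (3 : ℤ) ≤ p := by exact_mod_cast three_le_of_ne_two hp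
  -- The second weight is (p - 1)P(P + ε), so this bound makes it positive.
  have hpos : 1 ≤ ((p : ℤ) ^ (m - 1)) ∧ 1 ≤ ((p : ℤ) ^ (m - 1)) + sgn p m := by
    rcases sgn_eq_one_or_three_le hp hm h1 with ⟨h, h'⟩ | h
    · constructor <;> linarith
    · rcases sgn_eq_one_or_neg_one p m with h' | h' <;> constructor <;> linarith
  obtain ⟨hP, hPs⟩ := hpos
  have hw1 : (p - 1) * p ^ (2 * m - 2) ≠ 0 := by
    have := (Fact.out : p.Prime).pos
    have := three_le_of_ne_two hp
    exact mul_ne_zero (by omega) (by positivity)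
  have hw2pos : 0 < ((p : ℤ) - 1) * ((p : ℤ) ^ (2 * m - 2) + sgn p m * (p : ℤ) ^ (m - 1)) := by
    rw [pow_two_mul_sub_two, show ((p : ℤ) ^ (m - 1)) ^ 2 + sgn p m * (p : ℤ) ^ (m - 1) =
      (p : ℤ) ^ (m - 1) * ((p : ℤ) ^ (m - 1) + sgn p m) by ring]
    exact mul_pos (by linarith) (mul_pos (by linarith) (by linarith))
  have hinj : Function.Injective (codeword p (definingSet p F k l 0)) := by
    refine codeword_injective hp hm hF hr hd hr' hd' fun w hw => ?_
    rw [hnorm w hw, ha_def]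
    dsimp only
    split_ifs
    · exact hw1
    · omega
  have hcard : (Finset.univ.filter (fun t : ZMod p => t ≠ 0)).card = p - 1 := by
    rw [Finset.filter_ne', Finset.card_erase_of_mem (Finset.mem_univ _), Finset.card_univ,
      ZMod.card]
  have hwe : weightEnumerator (traceCode p (definingSet p F k l 0)) =
      1 + Polynomial.C ((p : ℤ) ^ (2 * m - 1) + sgn p m * (p - 1) * (p : ℤ) ^ (m - 1) - 1) *
              Polynomial.X ^ ((p - 1) * p ^ (2 * m - 2))
          + Polynomial.C (((p : ℤ) - 1) *
                ((p : ℤ) ^ (2 * m - 1) - sgn p m * (p : ℤ) ^ (m - 1))) *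
              Polynomial.X ^ (((p : ℤ) - 1) *
                ((p : ℤ) ^ (2 * m - 2) + sgn p m * (p : ℤ) ^ (m - 1))).toNat := by
    rw [weightEnumerator_traceCode hp hm hF hr hd hr' hd' hinj hnorm,
      Finset.sum_congr rfl (g := fun _ => Polynomial.X ^ (((p : ℤ) - 1) *
                ((p : ℤ) ^ (2 * m - 2) + sgn p m * (p : ℤ) ^ (m - 1))).toNat) (fun t ht => by
        simp only [ha_def, (Finset.mem_filter.mp ht).2, if_false]), Finset.sum_const, hcard,
      nsmul_eq_mul]
    simp only [ha_def, if_true, eq_intCast]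
    rw [Nat.cast_pred (Fact.out : p.Prime).pos]
    push_cast
    ring
  refine ⟨hn, finrank_traceCode hF hinj, ?_, hwe, ?_⟩
  · refine isWeightCode_two_of_weightEnumerator hwe ?_ ?_ hw1 (by omega) ?_
    · have hfac : (p : ℤ) ^ (2 * m - 1) + sgn p m * (p - 1) * (p : ℤ) ^ (m - 1) - 1 =
          ((p : ℤ) ^ (m - 1) + sgn p m) * (p * (p : ℤ) ^ (m - 1) - sgn p m) := by
        rw [pow_two_mul_sub_one hm]
        rcases sgn_eq_one_or_neg_one p m with h' | h' <;> rw [h'] <;> ring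
      rw [hfac]
      refine mul_ne_zero (by linarith) ?_
      rcases sgn_eq_one_or_neg_one p m with h' | h' <;> rw [h'] <;> nlinarith
    · rw [pow_two_mul_sub_one hm]
      refine mul_ne_zero (by linarith) ?_
      rcases sgn_eq_one_or_neg_one p m with h' | h' <;> rw [h'] <;> nlinarith
    · intro h
      have h2 : (((p - 1) * p ^ (2 * m - 2) : ℕ) : ℤ) =
          ((p : ℤ) - 1) * ((p : ℤ) ^ (2 * m - 2) + sgn p m * (p : ℤ) ^ (m - 1)) := by
        rw [h, Int.toNat_of_nonneg hw2pos.le]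
      push_cast [hp1] at h2
      have h3 : ((p : ℤ) - 1) * (sgn p m * (p : ℤ) ^ (m - 1)) = 0 := by linear_combination -h2
      rcases sgn_eq_one_or_neg_one p m with h' | h' <;> rw [h'] at h3 <;> nlinarith
  · rw [completeWeightEnumerator_traceCode hp hm hF hr hd hr' hd' hinj hsc]
    simp only [prod_X_pow_split]
    rw [Finset.sum_congr rfl (g := fun _ => MvPolynomial.X 0 ^ ((p : ℤ) ^ (2 * m - 2) - 1).toNat *
              ∏ ρ ∈ Finset.univ.filter (fun ρ : ZMod p => ρ ≠ 0),
                MvPolynomial.X ρ ^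
                  ((p : ℤ) ^ (2 * m - 2) + sgn p m * (p : ℤ) ^ (m - 1)).toNat) (fun t ht => by
        simp only [he_def, (Finset.mem_filter.mp ht).2, if_false, if_true]
        congr 1
        exact Finset.prod_congr rfl fun ρ hρ => by rw [if_neg (Finset.mem_filter.mp hρ).2]),
      Finset.sum_const, hcard, nsmul_eq_mul, ← hn, Int.toNat_natCast]
    simp only [he_def, if_true]
    rw [Finset.prod_congr rfl (s₁ := Finset.univ.filter (fun ρ : ZMod p => ρ ≠ 0))
      (g := fun ρ => MvPolynomial.X ρ ^ (p ^ (2 * m - 2)))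
      (fun ρ hρ => by rw [if_neg (Finset.mem_filter.mp hρ).2])]
    simp only [eq_intCast]
    rw [Nat.cast_pred (Fact.out : p.Prime).pos]
    push_cast
    ring

end Cases

/-! ### The case c ≠ 0 -/

lemma sum_ne_zero_mul_right {p : ℕ} [Fact p.Prime] {R : Type*} [AddCommMonoid R] {c : ZMod p}
    (hc : c ≠ 0) (h : ZMod p → R) :
    (∑ t ∈ Finset.univ.filter (fun t : ZMod p => t ≠ 0), h (t * c)) =
      ∑ s ∈ Finset.univ.filter (fun s : ZMod p => s ≠ 0), h s :=
  Finset.sum_equiv (Equiv.mulRight₀ c hc) (by simp [hc]) (by simp)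

lemma two_zmod_ne_zero {p : ℕ} [Fact p.Prime] (hp : p ≠ 2) : (2 : ZMod p) ≠ 0 :=
  Ring.two_ne_zero (by rwa [ZMod.ringChar_zmod_n])

lemma quadraticChar_neg_four_mul {p : ℕ} [Fact p.Prime] (hp : p ≠ 2) (s : ZMod p) :
    quadraticChar (ZMod p) (0 ^ 2 - 4 * s) = quadraticChar (ZMod p) (-s) := by
  rw [show (0 ^ 2 - 4 * s : ZMod p) = 2 ^ 2 * -s by ring, map_mul,
    quadraticChar_sq_one' (two_zmod_ne_zero hp), one_mul]

lemma quadraticChar_neg_pow_even {p : ℕ} [Fact p.Prime] {g : (ZMod p)ˣ} (j : ℕ) :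
    quadraticChar (ZMod p) (-(g : ZMod p) ^ (2 * j)) = quadraticChar (ZMod p) (-1) := by
  rw [neg_eq_neg_one_mul, map_mul, mul_comm 2 j, pow_mul,
    quadraticChar_sq_one' (pow_ne_zero _ g.ne_zero), mul_one]

lemma quadraticChar_neg_pow_odd {p : ℕ} [Fact p.Prime] (hp : p ≠ 2) {g : (ZMod p)ˣ}
    (hg : ∀ x : (ZMod p)ˣ, x ∈ Subgroup.zpowers g) (j : ℕ) :
    quadraticChar (ZMod p) (-(g : ZMod p) ^ (2 * j + 1)) = -quadraticChar (ZMod p) (-1) := by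
  rw [pow_succ, ← neg_mul, map_mul, quadraticChar_neg_pow_even, quadraticChar_generator hp hg]
  ring

section Cases

variable {p : ℕ} [Fact p.Prime] {F : Type*} [Field F] [Algebra (ZMod p) F] [Fintype F]
  {k l m : ℕ} [DecidableEq F] (hp : p ≠ 2) (hm : 0 < m) (hF : Fintype.card F = p ^ m) {r r' : ℕ}
  (hr : Odd r) (hd : m ∣ k * r) (hr' : Odd r') (hd' : m ∣ l * r')
include hp hm hF hr hd hr' hd'

lemma traceCode_ne_zero {c : ZMod p} (hc : c ≠ 0) {g : (ZMod p)ˣ}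
    (hg : ∀ x : (ZMod p)ˣ, x ∈ Subgroup.zpowers g) :
    ((definingSet p F k l c).card : ℤ) =
          (p : ℤ) ^ (2 * m - 1) - sgn p m * (p : ℤ) ^ (m - 1) ∧
      Module.finrank (ZMod p) (traceCode p (definingSet p F k l c)) = 2 * m ∧
      IsWeightCode 2 (traceCode p (definingSet p F k l c)) ∧
      weightEnumerator (traceCode p (definingSet p F k l c)) =
        1 + Polynomial.C (((p : ℤ) + 1) / 2 * (p : ℤ) ^ (2 * m - 1)
                + ((p : ℤ) - 1) / 2 * sgn p m * (p : ℤ) ^ (m - 1) - 1) *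
              Polynomial.X ^ ((p - 1) * p ^ (2 * m - 2))
          + Polynomial.C (((p : ℤ) - 1) / 2 *
                ((p : ℤ) ^ (2 * m - 1) - sgn p m * (p : ℤ) ^ (m - 1))) *
              Polynomial.X ^ (((p : ℤ) - 1) * (p : ℤ) ^ (2 * m - 2)
                - sgn p m * 2 * (p : ℤ) ^ (m - 1)).toNat ∧
      completeWeightEnumerator (traceCode p (definingSet p F k l c)) =
        MvPolynomial.X 0 ^ ((p : ℤ) ^ (2 * m - 1) - sgn p m * (p : ℤ) ^ (m - 1)).toNat
          + MvPolynomial.C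
                ((p : ℤ) ^ (2 * m - 1) + sgn p m * (p - 1) * (p : ℤ) ^ (m - 1) - 1) *
              MvPolynomial.X 0 ^
                ((p : ℤ) ^ (2 * m - 2) - sgn p m * (p : ℤ) ^ (m - 1)).toNat *
              ∏ ρ ∈ Finset.univ.filter (fun ρ : ZMod p => ρ ≠ 0),
                MvPolynomial.X ρ ^ (p ^ (2 * m - 2))
          + MvPolynomial.C ((p : ℤ) ^ (2 * m - 1) - sgn p m * (p : ℤ) ^ (m - 1)) *
              ((∑ j ∈ Finset.Icc 1 ((p - 1) / 2),
                  MvPolynomial.X 0 ^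
                    ((p : ℤ) ^ (2 * m - 2) + sgn p (m + 1) * (p : ℤ) ^ (m - 1)).toNat *
                  MvPolynomial.X (2 * (g : ZMod p) ^ j) ^ (p ^ (2 * m - 2)) *
                  MvPolynomial.X (-(2 * (g : ZMod p) ^ j)) ^ (p ^ (2 * m - 2)) *
                  ∏ ρ ∈ Finset.univ.filter (fun ρ : ZMod p =>
                      ρ ≠ 0 ∧ ρ ≠ 2 * (g : ZMod p) ^ j ∧ ρ ≠ -(2 * (g : ZMod p) ^ j)),
                    MvPolynomial.X ρ ^
                      ((p : ℤ) ^ (2 * m - 2) + sgn p m * (p : ℤ) ^ (m - 1) *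
                        quadraticChar (ZMod p) (ρ ^ 2 - 4 * (g : ZMod p) ^ (2 * j))).toNat)
                + ∑ j ∈ Finset.Icc 1 ((p - 1) / 2),
                  MvPolynomial.X 0 ^
                    ((p : ℤ) ^ (2 * m - 2) - sgn p (m + 1) * (p : ℤ) ^ (m - 1)).toNat *
                  ∏ ρ ∈ Finset.univ.filter (fun ρ : ZMod p => ρ ≠ 0),
                    MvPolynomial.X ρ ^
                      ((p : ℤ) ^ (2 * m - 2) + sgn p m * (p : ℤ) ^ (m - 1) *
                        quadraticChar (ZMod p)
                          (ρ ^ 2 - 4 * (g : ZMod p) ^ (2 * j + 1))).toNat) := by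
  have hn : ((definingSet p F k l c).card : ℤ) =
      (p : ℤ) ^ (2 * m - 1) - sgn p m * (p : ℤ) ^ (m - 1) := by
    rw [card_definingSet hp hm hF hr hd hr' hd', if_neg hc, add_zero]
  -- For t ≠ 0 the discriminant involves t and c only through s = tc, so summing over s removes c
  -- from the enumerators.
  set f : ZMod p → ZMod p → ℕ := fun s ρ => ((p : ℤ) ^ (2 * m - 2) + sgn p m * (p : ℤ) ^ (m - 1) *
    quadraticChar (ZMod p) (ρ ^ 2 - 4 * s)).toNat with hf_def
  set e : ZMod p → ZMod p → ℕ := fun t ρ =>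
    if t = 0 then
      if ρ = 0 then ((p : ℤ) ^ (2 * m - 2) - sgn p m * (p : ℤ) ^ (m - 1)).toNat
      else p ^ (2 * m - 2)
    else f (t * c) ρ with he_def
  -- There are P² + εPη(-s) zeros, which leaves weight (p - 1)P² - εP(1 + η(-s)). When η(-s) = -1
  -- this is the weight of the isotropic case.
  set b : ZMod p → ℕ := fun s => if quadraticChar (ZMod p) (-s) = 1 then
    (((p : ℤ) - 1) * (p : ℤ) ^ (2 * m - 2) - sgn p m * 2 * (p : ℤ) ^ (m - 1)).toNat
    else (p - 1) * p ^ (2 * m - 2) with hb_def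
  set a : ZMod p → ℕ := fun t => if t = 0 then (p - 1) * p ^ (2 * m - 2) else b (t * c) with ha_def
  have hp1 : ((p - 1 : ℕ) : ℤ) = p - 1 := Nat.cast_pred (Fact.out : p.Prime).pos
  have hsc : ∀ w : F × F, w ≠ 0 → ∀ ρ, symbolCount
      (codeword p (definingSet p F k l c) (adjointPair p k l m w)) ρ = e (traceForm p k l w) ρ := by
    intro w hw ρ
    by_cases ht : traceForm p k l w = 0
    · have h := symbolCount_isotropic hp hm hF hr hd hr' hd' hw ht c ρ
      rw [← pow_two_mul_sub_two, if_neg hc] at h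
      simp only [he_def, ht, if_true]
      split_ifs with hρ
      · rw [if_pos hρ, neg_mul, ← sub_eq_add_neg] at h
        rw [← h, Int.toNat_natCast]
      · rw [if_neg hρ, add_zero] at h
        exact_mod_cast h
    · have h := symbolCount_anisotropic hp hm hF hr hd hr' hd' hw ht c ρ
      rw [← pow_two_mul_sub_two, if_neg (fun h => hc h.1), sub_zero] at h
      simp only [he_def, hf_def, ht, if_false]
      -- The integer exponent is a cardinality, so `toNat` truncates nothing.
      rw [← h, Int.toNat_natCast]
  have hnorm : ∀ w : F × F, w ≠ 0 → hammingNorm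
      (codeword p (definingSet p F k l c) (adjointPair p k l m w)) = a (traceForm p k l w) := by
    intro w hw
    have h := hammingNorm_codeword_add hp hm hF hr hd hr' hd' c (adjointPair p k l m w)
    rw [if_neg hc] at h
    by_cases ht : traceForm p k l w = 0
    · rw [symbolCount_isotropic hp hm hF hr hd hr' hd' hw ht c 0, if_pos rfl, if_neg hc] at h
      simp only [ha_def, ht, if_true]
      zify
      rw [hp1, pow_two_mul_sub_two]
      linear_combination h
    · rw [symbolCount_anisotropic hp hm hF hr hd hr' hd' hw ht c 0, if_neg (fun h => hc h.1),
        quadraticChar_neg_four_mul hp] at h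
      simp only [ha_def, hb_def, ht, if_false]
      split_ifs with hs
      · have h' : ((p : ℤ) - 1) * (p : ℤ) ^ (2 * m - 2) - sgn p m * 2 * (p : ℤ) ^ (m - 1) =
            hammingNorm (codeword p (definingSet p F k l c) (adjointPair p k l m w)) := by
          rw [pow_two_mul_sub_two]
          rw [hs] at h
          linear_combination -h
        rw [h', Int.toNat_natCast]
      · have hs' := (quadraticChar_dichotomy (neg_ne_zero.mpr (mul_ne_zero ht hc))).resolve_left hs
        zify
        rw [hp1, pow_two_mul_sub_two]
        rw [hs'] at h
        linear_combination h
  have hp3 : (3 : ℤ) ≤ p := by exact_mod_cast three_le_of_ne_two hp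
  have hw1 : (p - 1) * p ^ (2 * m - 2) ≠ 0 := by
    have := (Fact.out : p.Prime).pos
    have := three_le_of_ne_two hp
    exact mul_ne_zero (by omega) (by positivity)
  have hP : 1 ≤ (p : ℤ) ^ (m - 1) := one_le_pow₀ (by linarith)
  have hw2pos : 0 < ((p : ℤ) - 1) * (p : ℤ) ^ (2 * m - 2) - sgn p m * 2 * (p : ℤ) ^ (m - 1) := by
    rw [pow_two_mul_sub_two, show ((p : ℤ) - 1) * ((p : ℤ) ^ (m - 1)) ^ 2
      - sgn p m * 2 * (p : ℤ) ^ (m - 1) =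
      (p : ℤ) ^ (m - 1) * (((p : ℤ) - 1) * (p : ℤ) ^ (m - 1) - 2 * sgn p m) by ring]
    refine mul_pos (by linarith) ?_
    rcases five_le_or_three_le hp hm with ⟨h, -⟩ | ⟨h, -⟩ | h
    · rw [h]; nlinarith
    · have h5 : (5 : ℤ) ≤ p := by exact_mod_cast h
      rcases sgn_eq_one_or_neg_one p m with h' | h' <;> rw [h'] <;> nlinarith
    · rcases sgn_eq_one_or_neg_one p m with h' | h' <;> rw [h'] <;> nlinarith
  have hinj : Function.Injective (codeword p (definingSet p F k l c)) := by
    refine codeword_injective hp hm hF hr hd hr' hd' fun w hw => ?_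
    rw [hnorm w hw]
    simp only [ha_def, hb_def]
    split_ifs
    · exact hw1
    · omega
    · exact hw1
  -- With p = 2n + 1 the integer divisions by 2 in the coefficients are exact.
  obtain ⟨n, hpn⟩ : Odd p := (Fact.out : p.Prime).odd_of_ne_two hp
  have hhalf : (p - 1) / 2 = n := by omega
  have hpn' : (p : ℤ) = 2 * n + 1 := by exact_mod_cast hpn
  have hhalf1 : ((p : ℤ) + 1) / 2 = n + 1 := by omega
  have hhalf2 : ((p : ℤ) - 1) / 2 = n := by omega
  have hneg := quadraticChar_dichotomy (F := ZMod p) (neg_ne_zero.mpr one_ne_zero)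
  have hwe : weightEnumerator (traceCode p (definingSet p F k l c)) =
      1 + Polynomial.C (((p : ℤ) + 1) / 2 * (p : ℤ) ^ (2 * m - 1)
                + ((p : ℤ) - 1) / 2 * sgn p m * (p : ℤ) ^ (m - 1) - 1) *
              Polynomial.X ^ ((p - 1) * p ^ (2 * m - 2))
          + Polynomial.C (((p : ℤ) - 1) / 2 *
                ((p : ℤ) ^ (2 * m - 1) - sgn p m * (p : ℤ) ^ (m - 1))) *
              Polynomial.X ^ (((p : ℤ) - 1) * (p : ℤ) ^ (2 * m - 2)
                - sgn p m * 2 * (p : ℤ) ^ (m - 1)).toNat := by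
    rw [weightEnumerator_traceCode hp hm hF hr hd hr' hd' hinj hnorm,
      Finset.sum_congr rfl (g := fun t => (fun s => Polynomial.X ^ b s) (t * c)) (fun t ht => by
        simp only [ha_def, (Finset.mem_filter.mp ht).2, if_false]),
      sum_ne_zero_mul_right hc (fun s => (Polynomial.X : Polynomial ℤ) ^ b s),
      -- Even and odd powers of g have opposite characters, so each pair 2j, 2j + 1 yields both
      -- weights once, whatever η(-1) is.
      sum_units_eq_sum_pow hp hg, Finset.sum_congr rfl (g := fun _ =>
        (Polynomial.X ^ ((p - 1) * p ^ (2 * m - 2)) + Polynomial.X ^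
          (((p : ℤ) - 1) * (p : ℤ) ^ (2 * m - 2) - sgn p m * 2 * (p : ℤ) ^ (m - 1)).toNat :
            Polynomial ℤ)) (fun j _ => by
        simp only [hb_def, quadraticChar_neg_pow_even, quadraticChar_neg_pow_odd hp hg]
        rcases hneg with h | h <;> rw [h] <;> norm_num
        exact add_comm _ _),
      Finset.sum_const, Nat.card_Icc, Nat.add_sub_cancel, hhalf, hhalf1, hhalf2, nsmul_eq_mul]
    simp only [ha_def, if_true, eq_intCast]
    have hpR : (p : Polynomial ℤ) = 2 * n + 1 := by exact_mod_cast congrArg Nat.cast hpn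
    push_cast
    generalize (Polynomial.X : Polynomial ℤ) ^ ((p - 1) * p ^ (2 * m - 2)) = A
    generalize (Polynomial.X : Polynomial ℤ) ^
      (((p : ℤ) - 1) * (p : ℤ) ^ (2 * m - 2) - sgn p m * 2 * (p : ℤ) ^ (m - 1)).toNat = B
    generalize (p : Polynomial ℤ) ^ (2 * m - 1) = Y
    generalize (p : Polynomial ℤ) ^ (m - 1) = Z
    rw [hpR]
    ring
  refine ⟨hn, finrank_traceCode hF hinj, ?_, hwe, ?_⟩
  · have hn1 : (1 : ℤ) ≤ n := by linarith
    refine isWeightCode_two_of_weightEnumerator hwe ?_ ?_ hw1 (by omega) ?_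
    · rw [hhalf1, hhalf2, pow_two_mul_sub_one hm, hpn']
      rw [hpn'] at hP
      generalize (2 * (n : ℤ) + 1) ^ (m - 1) = P at hP
      have h1 : P ≤ P ^ 2 := by nlinarith
      have h2 : (n : ℤ) * P ≤ n * P ^ 2 := mul_le_mul_of_nonneg_left h1 (by linarith)
      have h3 : 0 ≤ (n : ℤ) ^ 2 * P ^ 2 := by positivity
      have h4 : (n : ℤ) * 1 ≤ n * P ^ 2 :=
        mul_le_mul_of_nonneg_left (hP.trans h1) (by linarith)
      rcases sgn_eq_one_or_neg_one p m with h' | h' <;> rw [h'] <;> nlinarith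
    · rw [hhalf2, pow_two_mul_sub_one hm]
      refine mul_ne_zero (by linarith) ?_
      rcases sgn_eq_one_or_neg_one p m with h' | h' <;> rw [h'] <;> nlinarith
    · intro h
      have h2 : (((p - 1) * p ^ (2 * m - 2) : ℕ) : ℤ) =
          ((p : ℤ) - 1) * (p : ℤ) ^ (2 * m - 2) - sgn p m * 2 * (p : ℤ) ^ (m - 1) := by
        rw [h, Int.toNat_of_nonneg hw2pos.le]
      push_cast [hp1] at h2
      rcases sgn_eq_one_or_neg_one p m with h' | h' <;> rw [h'] at h2 <;> linarith
  · rw [completeWeightEnumerator_traceCode hp hm hF hr hd hr' hd' hinj hsc,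
      Finset.sum_congr rfl (g := fun t => (fun s => ∏ ρ : ZMod p,
        (MvPolynomial.X ρ : MvPolynomial (ZMod p) ℤ) ^ f s ρ) (t * c)) (fun t ht => by
          simp only [he_def, (Finset.mem_filter.mp ht).2, if_false]),
      sum_ne_zero_mul_right hc (fun s => ∏ ρ : ZMod p,
        (MvPolynomial.X ρ : MvPolynomial (ZMod p) ℤ) ^ f s ρ),
      sum_units_eq_sum_pow hp hg, Finset.sum_add_distrib, ← hn, Int.toNat_natCast]
    simp only [prod_X_pow_split]
    refine congrArg₂ (· + ·) (congrArg₂ (· + ·) rfl ?_)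
      (congrArg₂ (· * ·) rfl (congrArg₂ (· + ·) ?_ ?_))
    · rw [← mul_assoc]
      simp only [he_def, if_true]
      refine congrArg₂ (· * ·) rfl ?_
      exact Finset.prod_congr rfl fun ρ hρ => by rw [if_neg (Finset.mem_filter.mp hρ).2]
    · refine Finset.sum_congr rfl fun j _ => ?_
      -- At ρ = 0 the sign is ε η(-g^{2j}) = ε η(-1) = ε'; for an odd exponent it is -ε'.
      have hf0 : f ((g : ZMod p) ^ (2 * j)) 0 =
          ((p : ℤ) ^ (2 * m - 2) + sgn p (m + 1) * (p : ℤ) ^ (m - 1)).toNat := by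
        simp only [hf_def, quadraticChar_neg_four_mul hp, quadraticChar_neg_pow_even]
        rw [sgn_add_one hp, mul_right_comm]
      have hx : (2 * (g : ZMod p) ^ j) ≠ 0 :=
        mul_ne_zero (two_zmod_ne_zero hp) (pow_ne_zero _ g.ne_zero)
      -- At ρ = ±2g^j the discriminant vanishes. These two symbols are distinct and nonzero since p
      -- is odd, so they split off the product as separate factors.
      have hroot : ∀ ρ : ZMod p, ρ ^ 2 = (2 * (g : ZMod p) ^ j) ^ 2 →
          f ((g : ZMod p) ^ (2 * j)) ρ = p ^ (2 * m - 2) := by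
        intro ρ hρ
        have h0 : ρ ^ 2 - 4 * (g : ZMod p) ^ (2 * j) = 0 := by rw [hρ]; ring
        simp only [hf_def, h0, quadraticChar_zero, mul_zero, add_zero]
        exact Int.toNat_natCast (p ^ (2 * m - 2))
      rw [hf0, mul_assoc, mul_assoc]
      congr 1
      set x : ZMod p := 2 * (g : ZMod p) ^ j with hx_def
      have hxx : -x ≠ x := by
        intro h
        have h2 : 2 * x = 0 := by linear_combination -h
        exact mul_ne_zero (two_zmod_ne_zero hp) hx h2
      have hmem1 : x ∈ Finset.univ.filter (fun ρ : ZMod p => ρ ≠ 0) := by simpa using hx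
      have hmem2 : -x ∈ (Finset.univ.filter (fun ρ : ZMod p => ρ ≠ 0)).erase x := by
        simp [hx, hxx]
      rw [← Finset.mul_prod_erase _ _ hmem1, ← Finset.mul_prod_erase _ _ hmem2, hroot x rfl,
        hroot (-x) (neg_sq x)]
      congr 2
      refine Finset.prod_congr ?_ fun _ _ => rfl
      ext ρ
      simp only [Finset.mem_erase, Finset.mem_filter, Finset.mem_univ, true_and]
      tauto
    · refine Finset.sum_congr rfl fun j _ => ?_
      have hf0 : f ((g : ZMod p) ^ (2 * j + 1)) 0 =
          ((p : ℤ) ^ (2 * m - 2) - sgn p (m + 1) * (p : ℤ) ^ (m - 1)).toNat := by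
        simp only [hf_def, quadraticChar_neg_four_mul hp, quadraticChar_neg_pow_odd hp hg]
        rw [sgn_add_one hp]
        congr 1
        ring
      rw [hf0]

end Cases

end FewWeightCode

theorem theorem1 (p : ℕ) [Fact p.Prime] (hp : p ≠ 2) (m k l : ℕ) (hm : 0 < m)
    (F : Type*) [Field F] [Fintype F] [DecidableEq F] [Algebra (ZMod p) F]
    (hF : Fintype.card F = p ^ m)
    (hv : 2 * padicValNat 2 m =
      padicValNat 2 (Nat.gcd k m) + padicValNat 2 (Nat.gcd l m)) :
    -- the case `c = 0` (if `m = 1` and `p ≡ 3 (mod 4)`, then the defining set is empty)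
    ((m = 1 → p % 4 = 1) →
      ((definingSet p F k l 0).card : ℤ) =
          (p : ℤ) ^ (2 * m - 1) + sgn p m * (p - 1) * (p : ℤ) ^ (m - 1) - 1 ∧
      Module.finrank (ZMod p) (traceCode p (definingSet p F k l 0)) = 2 * m ∧
      IsWeightCode 2 (traceCode p (definingSet p F k l 0)) ∧
      weightEnumerator (traceCode p (definingSet p F k l 0)) =
        1 + Polynomial.C ((p : ℤ) ^ (2 * m - 1) + sgn p m * (p - 1) * (p : ℤ) ^ (m - 1) - 1) *
              Polynomial.X ^ ((p - 1) * p ^ (2 * m - 2))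
          + Polynomial.C (((p : ℤ) - 1) *
                ((p : ℤ) ^ (2 * m - 1) - sgn p m * (p : ℤ) ^ (m - 1))) *
              Polynomial.X ^ (((p : ℤ) - 1) *
                ((p : ℤ) ^ (2 * m - 2) + sgn p m * (p : ℤ) ^ (m - 1))).toNat ∧
      completeWeightEnumerator (traceCode p (definingSet p F k l 0)) =
        MvPolynomial.X 0 ^
            ((p : ℤ) ^ (2 * m - 1) + sgn p m * (p - 1) * (p : ℤ) ^ (m - 1) - 1).toNat
          + MvPolynomial.C
                ((p : ℤ) ^ (2 * m - 1) + sgn p m * (p - 1) * (p : ℤ) ^ (m - 1) - 1) *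
              MvPolynomial.X 0 ^
                ((p : ℤ) ^ (2 * m - 2) + sgn p m * (p - 1) * (p : ℤ) ^ (m - 1) - 1).toNat *
              ∏ ρ ∈ Finset.univ.filter (fun ρ : ZMod p => ρ ≠ 0),
                MvPolynomial.X ρ ^ (p ^ (2 * m - 2))
          + MvPolynomial.C (((p : ℤ) - 1) *
                ((p : ℤ) ^ (2 * m - 1) - sgn p m * (p : ℤ) ^ (m - 1))) *
              MvPolynomial.X 0 ^ ((p : ℤ) ^ (2 * m - 2) - 1).toNat *
              ∏ ρ ∈ Finset.univ.filter (fun ρ : ZMod p => ρ ≠ 0),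
                MvPolynomial.X ρ ^
                  ((p : ℤ) ^ (2 * m - 2) + sgn p m * (p : ℤ) ^ (m - 1)).toNat) ∧
    -- the case `c ≠ 0`, with `g` any generator of the multiplicative group
    (∀ c : ZMod p, c ≠ 0 → ∀ g : (ZMod p)ˣ, (∀ x : (ZMod p)ˣ, x ∈ Subgroup.zpowers g) →
      ((definingSet p F k l c).card : ℤ) =
          (p : ℤ) ^ (2 * m - 1) - sgn p m * (p : ℤ) ^ (m - 1) ∧
      Module.finrank (ZMod p) (traceCode p (definingSet p F k l c)) = 2 * m ∧
      IsWeightCode 2 (traceCode p (definingSet p F k l c)) ∧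
      weightEnumerator (traceCode p (definingSet p F k l c)) =
        1 + Polynomial.C (((p : ℤ) + 1) / 2 * (p : ℤ) ^ (2 * m - 1)
                + ((p : ℤ) - 1) / 2 * sgn p m * (p : ℤ) ^ (m - 1) - 1) *
              Polynomial.X ^ ((p - 1) * p ^ (2 * m - 2))
          + Polynomial.C (((p : ℤ) - 1) / 2 *
                ((p : ℤ) ^ (2 * m - 1) - sgn p m * (p : ℤ) ^ (m - 1))) *
              Polynomial.X ^ (((p : ℤ) - 1) * (p : ℤ) ^ (2 * m - 2)
                - sgn p m * 2 * (p : ℤ) ^ (m - 1)).toNat ∧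
      completeWeightEnumerator (traceCode p (definingSet p F k l c)) =
        MvPolynomial.X 0 ^ ((p : ℤ) ^ (2 * m - 1) - sgn p m * (p : ℤ) ^ (m - 1)).toNat
          + MvPolynomial.C
                ((p : ℤ) ^ (2 * m - 1) + sgn p m * (p - 1) * (p : ℤ) ^ (m - 1) - 1) *
              MvPolynomial.X 0 ^
                ((p : ℤ) ^ (2 * m - 2) - sgn p m * (p : ℤ) ^ (m - 1)).toNat *
              ∏ ρ ∈ Finset.univ.filter (fun ρ : ZMod p => ρ ≠ 0),
                MvPolynomial.X ρ ^ (p ^ (2 * m - 2))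
          + MvPolynomial.C ((p : ℤ) ^ (2 * m - 1) - sgn p m * (p : ℤ) ^ (m - 1)) *
              ((∑ j ∈ Finset.Icc 1 ((p - 1) / 2),
                  MvPolynomial.X 0 ^
                    ((p : ℤ) ^ (2 * m - 2) + sgn p (m + 1) * (p : ℤ) ^ (m - 1)).toNat *
                  MvPolynomial.X (2 * (g : ZMod p) ^ j) ^ (p ^ (2 * m - 2)) *
                  MvPolynomial.X (-(2 * (g : ZMod p) ^ j)) ^ (p ^ (2 * m - 2)) *
                  ∏ ρ ∈ Finset.univ.filter (fun ρ : ZMod p =>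
                      ρ ≠ 0 ∧ ρ ≠ 2 * (g : ZMod p) ^ j ∧ ρ ≠ -(2 * (g : ZMod p) ^ j)),
                    MvPolynomial.X ρ ^
                      ((p : ℤ) ^ (2 * m - 2) + sgn p m * (p : ℤ) ^ (m - 1) *
                        quadraticChar (ZMod p) (ρ ^ 2 - 4 * (g : ZMod p) ^ (2 * j))).toNat)
                + ∑ j ∈ Finset.Icc 1 ((p - 1) / 2),
                  MvPolynomial.X 0 ^
                    ((p : ℤ) ^ (2 * m - 2) - sgn p (m + 1) * (p : ℤ) ^ (m - 1)).toNat *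
                  ∏ ρ ∈ Finset.univ.filter (fun ρ : ZMod p => ρ ≠ 0),
                    MvPolynomial.X ρ ^
                      ((p : ℤ) ^ (2 * m - 2) + sgn p m * (p : ℤ) ^ (m - 1) *
                        quadraticChar (ZMod p)
                          (ρ ^ 2 - 4 * (g : ZMod p) ^ (2 * j + 1))).toNat)) := by
  obtain ⟨hk, hl⟩ := padicValNat_gcd_eq hm hv
  obtain ⟨r, hr, hd⟩ := exists_odd_dvd_mul hm hk
  obtain ⟨r', hr', hd'⟩ := exists_odd_dvd_mul hm hl
  exact ⟨fun h1 => traceCode_zero hp hm hF hr hd hr' hd' h1,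
    fun c hc g hg => traceCode_ne_zero hp hm hF hr hd hr' hd' hc hg⟩
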